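/- Let $G$ be a locally compact Hausdorff topological group and $R$ a ring. A $G$-pair $(X,A)$ is a topological space $X$ with a continuous left $G$-action together with a $G$-invariant subspace $A$. Let $(\mathfrak H_*^G,\partial_*)$ be a generalized equivariant homology theory: a covariant functor from $G$-pairs and continuous equivariant maps of pairs to $\mathbb Z$-graded $R$-modules, with natural $R$-linear maps $\partial_n:\mathfrak H_n^G(X,A)\to\mathfrak H_{n-1}^G(A)$ (where $\mathfrak H_*^G(A)=\mathfrak H_*^G(A,\emptyset)$), such that the long sequence of every $G$-pair is exact, $G$-homotopic maps of pairs induce equal maps, and $\mathfrak H_*^G(X\setminus U,A\setminus U)\to\mathfrak H_*^G(X,A)$ is an isomorphism whenever $U$ is a $G$-invariant subset with $\overline U\subseteq\operatorname{Int}(A)$. Suppose that 1. $\mathfrak H_*^G$ has compact supports: every class in $\mathfrak H_*^G(X,A)$, for any $G$-pair $(X,A)$, is the image of a class in $\mathfrak H_*^G(Y,B)$ for some $G$-pair $(Y,B)\subseteq(X,A)$ with $Y$ and $B$ compact (compactness does not include the Hausdorff property); 2. there is an integer $n_0$ such that $\mathfrak H_n^G(G/H)=0$ for all integers $n\le n_0$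 and all subgroups $H\le G$. An abstract simplicial $G$-complex is a collection $\mathfrak S$ of finite nonempty subsets of a $G$-set $V$ that contains all $\{v\}$ with $v\in V$, is closed under passing to nonempty subsets and under the action of $G$, and is such that whenever $S\in\mathfrak S$ and $gS=S$, $g$ fixes every element of $S$. For $S\in\mathfrak S$ let $G_S$ be its stabilizer and $|S|$ the closed simplex with vertex set $S$. The realization of $\mathfrak S$ is the quotient of $\coprod_{S\in\mathfrak S}G/G_S\times|S|$ that identifies $(aG_S,x)$ with $(bG_T,y)$ whenever there are $g\in G$ and $Q\in\mathfrak S$ with $x\in|Q|\subseteq|S|$, $y=gx\in|gQ|\subseteq|T|$ and $a^{-1}bg\in G_Q$, with the quotient topology and the $G$-action induced from the left action on the factors $G/G_S$. Let $\mathfrak R\subseteq\mathfrak S$ be abstract simplicial $G$-complexes (the vertex set of $\mathfrak R$ may be smaller than that of $\mathfrak S$), let $X$ be the realization of $\mathfrak S$ and let $A\subseteq X$ be the $G$-subspace that is the union of the images of $G/G_S\times|S|$, $S\in\mathfrak R$. For $p\in\mathbb Z$ let $X^p$ be the union of the images of all $G/G_S\times\operatorname{int}|S|$ with $S\in\mathfrak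 S$ and $\dim S\le p$, and let $X_p=X^p\cup A$ (so $X_p=A$ for $p<0$). Suppose that every $X_p$, $p\in\mathbb Z$, is compact. Then $\{X_p\}_{p\in\mathbb Z}$, which is a filtration of $(X,A)$ by $G$-subspaces, is homologically stable with respect to $\mathfrak H_*^G$: for every $n\in\mathbb Z$ there is $p_n\in\mathbb Z$ such that the map $\mathfrak H_n^G(X_p,A)\to\mathfrak H_n^G(X,A)$ induced by inclusion is an isomorphism for all integers $p\ge p_n$. -/

import Mathlib

open CategoryTheory Topology
open scoped Pointwise unitInterval

universe u v w

/-! ### Pairs of `G`-spaces -/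

/-- A subset `Y` of a `G`-set is `G`-invariant. -/
def IsGInvariant (G : Type*) {X : Type*} [SMul G X] (Y : Set X) : Prop :=
  ∀ (g : G), ∀ x ∈ Y, g • x ∈ Y

/-- A `G`-pair `(X, A)`: a topological space `X` with a continuous left `G`-action, together with
a `G`-subspace `A` of `X`. -/
structure GPair (G : Type u) [Group G] [TopologicalSpace G] : Type (u + 1) where
  carrier : Type u
  [top : TopologicalSpace carrier]
  [act : MulAction G carrier]
  [cont : ContinuousSMul G carrier]
  sub : Set carrier
  sub_inv : IsGInvariant G sub

namespace GPair

attribute [instance] GPair.top GPair.act GPair.cont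

variable {G : Type u} [Group G] [TopologicalSpace G]

/-- Continuous equivariant maps of `G`-pairs. -/
@[ext]
structure Hom (P Q : GPair.{u} G) where
  toFun : P.carrier → Q.carrier
  continuous_toFun : Continuous toFun
  map_smul : ∀ (g : G) (x : P.carrier), toFun (g • x) = g • toFun x
  map_sub : ∀ x ∈ P.sub, toFun x ∈ Q.sub

instance : Category (GPair.{u} G) where
  Hom := Hom
  id P := ⟨fun x => x, continuous_id, fun _ _ => rfl, fun _ h => h⟩
  comp f f₂ := ⟨fun x => f₂.toFun (f.toFun x), f₂.continuous_toFun.comp f.continuous_toFun,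
    fun g x => by rw [f.map_smul, f₂.map_smul], fun x h => f₂.map_sub _ (f.map_sub x h)⟩

/-- The `G`-action on an invariant subset. -/
@[reducible]
def invAct {X : Type u} [MulAction G X] (Y : Set X) (hY : IsGInvariant G Y) : MulAction G Y where
  smul g y := ⟨g • y.1, hY g y.1 y.2⟩
  one_smul y := Subtype.ext (one_smul G y.1)
  mul_smul g h y := Subtype.ext (mul_smul g h y.1)

/-- For invariant subsets `B ⊆ Y` of `X`, the `G`-pair `(Y, B)` (with the subspace topology). -/
def subpair (P : GPair.{u} G) (Y B : Set P.carrier) (hY : IsGInvariant G Y)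
    (hB : IsGInvariant G B) : GPair.{u} G :=
  letI : MulAction G Y := invAct Y hY
  { carrier := Y
    cont := ⟨Continuous.subtype_mk
      (continuous_fst.smul (continuous_subtype_val.comp continuous_snd)) _⟩
    sub := {y | y.1 ∈ B}
    sub_inv := fun g y hy => hB g y.1 hy }

/-- The inclusion `(Y, B) → (X, A)`, where `B ⊆ A`. -/
def subpairIncl (P : GPair.{u} G) (Y B : Set P.carrier) (hY : IsGInvariant G Y)
    (hB : IsGInvariant G B) (hBA : B ⊆ P.sub) : P.subpair Y B hY hB ⟶ P where
  toFun y := y.1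
  continuous_toFun := continuous_subtype_val
  map_smul _ _ := rfl
  map_sub _ hy := hBA hy

theorem isGInvariant_empty (P : GPair.{u} G) : IsGInvariant G (∅ : Set P.carrier) :=
  fun _ _ h => h

/-- A `G`-space `X`, viewed as the `G`-pair `(X, ∅)`. -/
def space (G : Type u) [Group G] [TopologicalSpace G] (X : Type u) [TopologicalSpace X]
    [MulAction G X] [ContinuousSMul G X] : GPair.{u} G where
  carrier := X
  sub := ∅
  sub_inv _ _ h := h

/-- The functor `(X, A) ↦ (A, ∅)`. -/
def restrict (G : Type u) [Group G] [TopologicalSpace G] : GPair.{u} G ⥤ GPair.{u} G where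
  obj P := P.subpair P.sub ∅ P.sub_inv P.isGInvariant_empty
  map {P Q} f :=
    { toFun := fun a => ⟨f.toFun a.1, f.map_sub a.1 a.2⟩
      continuous_toFun :=
        (f.continuous_toFun.comp continuous_subtype_val).subtype_mk _
      map_smul := fun g a => Subtype.ext (f.map_smul g a.1)
      map_sub := fun _ h => h }

/-- The inclusion `(A, ∅) → (X, ∅)`. -/
def inclSub (P : GPair.{u} G) : (restrict G).obj P ⟶ space G P.carrier where
  toFun a := a.1
  continuous_toFun := continuous_subtype_val
  map_smul _ _ := rfl
  map_sub _ h := h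

/-- The inclusion `(X, ∅) → (X, A)`. -/
def inclSpace (P : GPair.{u} G) : space G P.carrier ⟶ P where
  toFun x := x
  continuous_toFun := continuous_id
  map_smul _ _ := rfl
  map_sub _ h := h.elim

/-- Two maps `(X, A) → (Y, B)` are `G`-homotopic: there is an equivariant map of pairs
`(X, A) × [0,1] → (Y, B)` joining them, with `G` acting trivially on `[0,1]`. -/
def Homotopic {P Q : GPair.{u} G} (f f₂ : P ⟶ Q) : Prop :=
  ∃ F : P.carrier × I → Q.carrier, Continuous F ∧
    (∀ (g : G) (x : P.carrier) (t : I), F (g • x, t) = g • F (x, t)) ∧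
    (∀ x ∈ P.sub, ∀ t : I, F (x, t) ∈ Q.sub) ∧
    (∀ x, F (x, 0) = f.toFun x) ∧ (∀ x, F (x, 1) = f₂.toFun x)

theorem isGInvariant_diff {P : GPair.{u} G} {Y U : Set P.carrier} (hY : IsGInvariant G Y)
    (hU : IsGInvariant G U) : IsGInvariant G (Y \ U) := fun g x hx =>
  ⟨hY g x hx.1, fun h => hx.2 (by simpa using hU g⁻¹ _ h)⟩

theorem isGInvariant_compl {P : GPair.{u} G} {U : Set P.carrier}
    (hU : IsGInvariant G U) : IsGInvariant G Uᶜ := fun g x hx h =>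
  hx (by simpa using hU g⁻¹ _ h)

end GPair

/-! ### Generalized equivariant homology theories -/

/-- A generalized equivariant homology theory on the category of `G`-pairs, with values in graded
`R`-modules: functors `H n` (`n ∈ ℤ`), natural boundary maps
`∂ n : H n (X, A) → H (n - 1) (A, ∅)`, and the exactness, homotopy and excision axioms. -/
structure EquivariantHomologyTheory (G : Type u) [Group G] [TopologicalSpace G]
    (R : Type v) [Ring R] where
  H : ℤ → GPair.{u} G ⥤ ModuleCat.{w} R
  bd : ∀ n : ℤ, H n ⟶ GPair.restrict G ⋙ H (n - 1)
  exact_space : ∀ (P : GPair.{u} G) (n : ℤ),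
    Function.Exact ((H n).map P.inclSub).hom ((H n).map P.inclSpace).hom
  exact_pair : ∀ (P : GPair.{u} G) (n : ℤ),
    Function.Exact ((H n).map P.inclSpace).hom ((bd n).app P).hom
  exact_sub : ∀ (P : GPair.{u} G) (n : ℤ),
    Function.Exact ((bd n).app P).hom ((H (n - 1)).map P.inclSub).hom
  homotopy : ∀ {P Q : GPair.{u} G} (f f₂ : P ⟶ Q), GPair.Homotopic f f₂ →
    ∀ n : ℤ, (H n).map f = (H n).map f₂
  excision : ∀ (P : GPair.{u} G) (U : Set P.carrier) (hU : IsGInvariant G U),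
    closure U ⊆ interior P.sub → ∀ n : ℤ,
    IsIso ((H n).map (P.subpairIncl Uᶜ (P.sub \ U) (GPair.isGInvariant_compl hU)
      (GPair.isGInvariant_diff P.sub_inv hU) Set.sdiff_subset))

namespace EquivariantHomologyTheory

variable {G : Type u} [Group G] [TopologicalSpace G] {R : Type v} [Ring R]

/-- Compact supports: every homology class of a `G`-pair `(X, A)` is the image of a class of
some compact `G`-pair `(Y, B) ⊆ (X, A)`. -/
def HasCompactSupports (h : EquivariantHomologyTheory.{u, v, w} G R) : Prop :=
  ∀ (P : GPair.{u} G) (n : ℤ) (x : (h.H n).obj P),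
    ∃ (Y B : Set P.carrier) (hY : IsGInvariant G Y) (hB : IsGInvariant G B) (hBA : B ⊆ P.sub),
      B ⊆ Y ∧ IsCompact Y ∧ IsCompact B ∧
      ∃ y : (h.H n).obj (P.subpair Y B hY hB),
        ((h.H n).map (P.subpairIncl Y B hY hB hBA)).hom y = x

end EquivariantHomologyTheory

/-! ### Filtrations and homological stability -/

/-- A `G`-filtration of the `G`-pair `(X, A)`: an increasing family of `G`-subspaces
`level k` (`k ∈ ℤ`) of `X` with union `X` and with `level k = A` for `k < 0`. -/
structure GFiltration {G : Type u} [Group G] [TopologicalSpace G] (P : GPair.{u} G) where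
  level : ℤ → Set P.carrier
  invariant : ∀ k, IsGInvariant G (level k)
  mono : ∀ k, level k ⊆ level (k + 1)
  union : ⋃ k, level k = Set.univ
  neg : ∀ k, k < 0 → level k = P.sub

/-- Homological stability: for every `n` there is `pₙ` such that
`H n (X_p, A) → H n (X, A)` is an isomorphism for all `p ≥ pₙ`. -/
def GFiltration.HomologicallyStable {G : Type u} [Group G] [TopologicalSpace G]
    {R : Type v} [Ring R] {P : GPair.{u} G} (F : GFiltration P)
    (h : EquivariantHomologyTheory.{u, v, w} G R) : Prop :=
  ∀ n : ℤ, ∃ pn : ℤ, ∀ p : ℤ, pn ≤ p →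
    IsIso ((h.H n).map
      (P.subpairIncl (F.level p) P.sub (F.invariant p) P.sub_inv subset_rfl))

/-! ### Simplicial `G`-complexes -/

/-- An abstract simplicial `G`-complex whose simplices are finite nonempty subsets of the `G`-set
`V`: a collection of finite nonempty sets, closed under passing to nonempty subsets and under `G`,
such that an element of `G` that maps a simplex onto itself fixes each of its vertices.
The vertex set is the invariant subset of all `v ∈ V` with `{v}` a simplex; it need not be all
of `V`, so that a complex and its subcomplexes may share the same `V`. -/
structure AbstractSimplicialGComplex (G V : Type*) [Group G] [MulAction G V] [DecidableEq V]
    extends PreAbstractSimplicialComplex V where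
  smul_mem : ∀ (g : G), ∀ s ∈ faces, g • s ∈ faces
  fixed : ∀ s ∈ faces, ∀ g : G, g • s = s → ∀ v ∈ s, g • v = v

namespace AbstractSimplicialGComplex

set_option linter.unusedSectionVars false

variable {G V : Type*} [Group G] [MulAction G V] [DecidableEq V]

theorem mem_of_subset (K : AbstractSimplicialGComplex G V) {s t : Finset V} (hs : s ∈ K.faces)
    (hts : t ⊆ s) (ht : t.Nonempty) : t ∈ K.faces :=
  (K.isRelLowerSet_faces hs).2 hts ht

/-- The underlying set of the realization of `K`: convex combinations of vertices of `K`, written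
in barycentric coordinates, whose support is a simplex of `K`. -/
@[ext]
structure Realization (K : AbstractSimplicialGComplex G V) where
  coords : V →₀ ℝ
  nonneg : ∀ v, 0 ≤ coords v
  sum_eq : (coords.sum fun _ a => a) = 1
  support_mem : coords.support ∈ K.faces

theorem support_mapDomain_smul (g : G) (x : V →₀ ℝ) :
    (x.mapDomain (g • ·)).support = g • x.support := by
  rw [Finsupp.mapDomain_support_of_injective (MulAction.injective g)]
  rfl

theorem mapDomain_smul_apply (g : G) (x : V →₀ ℝ) (v : V) :
    x.mapDomain (g • ·) v = x (g⁻¹ • v) := by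
  have h := Finsupp.mapDomain_apply (MulAction.injective g) x (g⁻¹ • v)
  simpa using h

/-- `G` acts on the realization by the linear extension of its action on vertices. -/
noncomputable instance (K : AbstractSimplicialGComplex G V) : MulAction G K.Realization where
  smul g x :=
    { coords := x.coords.mapDomain (g • ·)
      nonneg := fun v => by rw [mapDomain_smul_apply]; exact x.nonneg _
      sum_eq := by
        rw [Finsupp.sum_mapDomain_index (fun _ => rfl) (fun _ _ _ => rfl)]; exact x.sum_eq
      support_mem := by
        rw [support_mapDomain_smul]; exact K.smul_mem g _ x.support_mem }
  one_smul x := Realization.ext (by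
    change x.coords.mapDomain ((1 : G) • ·) = x.coords
    ext v; rw [mapDomain_smul_apply]; simp)
  mul_smul g h x := Realization.ext (by
    change x.coords.mapDomain ((g * h) • ·) = (x.coords.mapDomain (h • ·)).mapDomain (g • ·)
    ext v; rw [mapDomain_smul_apply, mapDomain_smul_apply, mapDomain_smul_apply, mul_inv_rev,
      mul_smul])

theorem coords_smul (K : AbstractSimplicialGComplex G V) (g : G) (x : K.Realization) :
    (g • x).coords = x.coords.mapDomain (g • ·) := rfl

/-- A point of the standard simplex on the vertex set `s`, as a finitely supported function. -/
noncomputable def extend {s : Finset V} (x : stdSimplex ℝ s) : V →₀ ℝ :=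
  Finsupp.onFinset s (fun v => if h : v ∈ s then x.1 ⟨v, h⟩ else 0) (by
    intro v hv; by_contra h; simp [h] at hv)

theorem extend_apply {s : Finset V} (x : stdSimplex ℝ s) (v : V) :
    extend x v = if h : v ∈ s then x.1 ⟨v, h⟩ else 0 := rfl

theorem support_extend_subset {s : Finset V} (x : stdSimplex ℝ s) : (extend x).support ⊆ s :=
  Finsupp.support_onFinset_subset

theorem sum_extend {s : Finset V} (x : stdSimplex ℝ s) :
    ((extend x).sum fun _ a => a) = 1 := by
  rw [Finsupp.sum_of_support_subset _ (support_extend_subset x) _ (fun _ _ => rfl),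
    ← Finset.sum_coe_sort, ← x.2.2]
  exact Finset.sum_congr rfl fun v _ => by simp [extend_apply]

/-- The closed simplex `s`, as a subset of the realization. -/
noncomputable def simplexPoint (K : AbstractSimplicialGComplex G V) (s : K.faces)
    (x : stdSimplex ℝ s.1) : K.Realization :=
  ⟨extend x, fun v => by rw [extend_apply]; split_ifs; exacts [x.2.1 _, le_rfl],
    sum_extend x, K.mem_of_subset s.2 (support_extend_subset x) (by
      rw [Finset.nonempty_iff_ne_empty]
      intro h
      have := sum_extend x
      simp [Finsupp.sum, h] at this)⟩

theorem smul_simplexPoint_of_mem (K : AbstractSimplicialGComplex G V) (s : K.faces)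
    (x : stdSimplex ℝ s.1) (g : G) (hg : g ∈ MulAction.stabilizer G s.1) :
    g • K.simplexPoint s x = K.simplexPoint s x := by
  apply Realization.ext
  have hfix := K.fixed s.1 s.2 g hg
  change (extend x).mapDomain (g • ·) = extend x
  rw [Finsupp.mapDomain_congr (g := id), Finsupp.mapDomain_id]
  exact fun v hv => hfix v (support_extend_subset x hv)

/-- The characteristic map `χ_s : G/G_s × s → top_G(K)`, `(gG_s, x) ↦ g x`, of the simplex `s`;
here `G_s` is the stabilizer of `s`. -/
noncomputable def char (K : AbstractSimplicialGComplex G V) (s : K.faces) :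
    (G ⧸ MulAction.stabilizer G s.1) × stdSimplex ℝ s.1 → K.Realization :=
  fun z => Quotient.liftOn' z.1 (fun g => g • K.simplexPoint s z.2) (by
    intro a b hab
    rw [QuotientGroup.leftRel_apply] at hab
    have := K.smul_simplexPoint_of_mem s z.2 _ hab
    change a • _ = b • _
    rw [← this, ← mul_smul, mul_inv_cancel_left]
    rw [this])

theorem char_mk (K : AbstractSimplicialGComplex G V) (s : K.faces) (g : G)
    (x : stdSimplex ℝ s.1) :
    K.char s (QuotientGroup.mk g, x) = g • K.simplexPoint s x := rfl

theorem smul_char (K : AbstractSimplicialGComplex G V) (s : K.faces) (g : G)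
    (z : (G ⧸ MulAction.stabilizer G s.1) × stdSimplex ℝ s.1) :
    g • K.char s z = K.char s (g • z.1, z.2) := by
  obtain ⟨c, x⟩ := z
  induction c using QuotientGroup.induction_on with
  | H a => rw [char_mk, ← mul_smul]; rfl

/-- Every point of the realization lies in the interior of the simplex spanned by its support. -/
theorem exists_simplexPoint (K : AbstractSimplicialGComplex G V) (y : K.Realization) :
    ∃ x : stdSimplex ℝ y.coords.support, (∀ v, 0 < x.1 v) ∧
      K.simplexPoint ⟨y.coords.support, y.support_mem⟩ x = y := by
  refine ⟨⟨fun v => y.coords v.1, fun v => y.nonneg _, ?_⟩, fun v => ?_, ?_⟩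
  · exact (Finset.sum_coe_sort _ _).trans y.sum_eq
  · exact lt_of_le_of_ne (y.nonneg _) (Finsupp.mem_support_iff.1 v.2).symm
  · apply Realization.ext
    ext v
    change extend _ v = _
    rw [extend_apply]
    split_ifs with h
    · rfl
    · exact (Finsupp.notMem_support_iff.1 h).symm

/-- The set underlying the realization is the quotient of the disjoint union of the `G/G_s × s` by
the relation that identifies `(aG_s, x)` with `(bG_t, y)` if there are `g ∈ G` and a simplex `r`
with `x ∈ r ⊆ s`, `y = g x ∈ g r ⊆ t` and `a⁻¹ b g ∈ G_r`. -/
theorem char_eq_char_iff (K : AbstractSimplicialGComplex G V) (s t : K.faces) (a b : G)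
    (x : stdSimplex ℝ s.1) (y : stdSimplex ℝ t.1) :
    K.char s (QuotientGroup.mk a, x) = K.char t (QuotientGroup.mk b, y) ↔
      ∃ (g : G) (r : K.faces), (K.simplexPoint s x).coords.support ⊆ r.1 ∧ r.1 ⊆ s.1 ∧
        K.simplexPoint t y = g • K.simplexPoint s x ∧ g • r.1 ⊆ t.1 ∧
        a⁻¹ * b * g ∈ MulAction.stabilizer G r.1 := by
  rw [char_mk, char_mk]
  constructor
  · intro h
    have hy : K.simplexPoint t y = (b⁻¹ * a) • K.simplexPoint s x := by
      rw [mul_smul, h, inv_smul_smul]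
    refine ⟨b⁻¹ * a, ⟨(K.simplexPoint s x).coords.support, (K.simplexPoint s x).support_mem⟩,
      subset_rfl, support_extend_subset x, hy, ?_, ?_⟩
    · rw [← support_mapDomain_smul, ← coords_smul, ← hy]
      exact support_extend_subset y
    · have : a⁻¹ * b * (b⁻¹ * a) = 1 := by group
      rw [this]; exact one_mem _
  · rintro ⟨g, r, hxr, -, hy, -, hg⟩
    have hfix := K.fixed r.1 r.2 _ hg
    have : (a⁻¹ * b * g) • K.simplexPoint s x = K.simplexPoint s x := by
      apply Realization.ext
      rw [coords_smul, Finsupp.mapDomain_congr (g := id), Finsupp.mapDomain_id]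
      exact fun v hv => hfix v (hxr hv)
    rw [hy, ← this, ← mul_smul, ← mul_smul]
    rw [show a * (a⁻¹ * b * g) = b * g by group, this]

section Topology

variable [TopologicalSpace G]

/-- The realization carries the coherent topology with respect to the images of the maps `χ_s`,
each of which carries the quotient topology: a set is open if and only if its preimage under every
`χ_s` is open. -/
noncomputable instance (K : AbstractSimplicialGComplex G V) :
    TopologicalSpace K.Realization :=
  ⨆ s : K.faces, TopologicalSpace.coinduced (K.char s) inferInstance

theorem isOpen_iff (K : AbstractSimplicialGComplex G V) (U : Set K.Realization) :
    IsOpen U ↔ ∀ s : K.faces, IsOpen (K.char s ⁻¹' U) := by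
  rw [isOpen_iSup_iff]; rfl

theorem isQuotientMap_char (K : AbstractSimplicialGComplex G V) :
    IsQuotientMap (fun z : Σ s : K.faces,
      (G ⧸ MulAction.stabilizer G s.1) × stdSimplex ℝ s.1 => K.char z.1 z.2) := by
  refine ⟨isCoinducing_iff.2 fun U => ?_, fun y => ?_⟩
  · rw [isOpen_iff, isOpen_sigma_iff]; rfl
  · obtain ⟨x, -, hx⟩ := K.exists_simplexPoint y
    exact ⟨⟨⟨_, y.support_mem⟩, (QuotientGroup.mk 1, x)⟩, by rw [char_mk, one_smul, hx]⟩

instance [ContinuousMul G] [LocallyCompactSpace G] (K : AbstractSimplicialGComplex G V) :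
    ContinuousSMul G K.Realization where
  continuous_smul := by
    have key : Continuous fun p : K.Realization × G => p.2 • p.1 := by
      apply K.isQuotientMap_char.continuous_lift_prod_left
      rw [← (Homeomorph.sigmaProdDistrib (Y := G)).symm.comp_continuous_iff',
        continuous_sigma_iff]
      intro s
      have hs : Continuous (K.char s) := by
        rw [continuous_def]; exact fun U hU => (K.isOpen_iff U).1 hU s
      have : Continuous fun p : ((G ⧸ MulAction.stabilizer G s.1) × stdSimplex ℝ s.1) × G =>
          K.char s (p.2 • p.1.1, p.1.2) := by fun_prop
      refine this.congr fun p => ?_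
      exact (K.smul_char s p.2 p.1).symm
    exact key.comp continuous_swap

end Topology

/-- The subset of the realization of `K` formed by the closed equivariant cells of the simplices
of `L`. -/
def subspaceOf (K L : AbstractSimplicialGComplex G V) : Set K.Realization :=
  {y | ∃ s : K.faces, s.1 ∈ L.faces ∧ ∃ z, K.char s z = y}

/-- The open equivariant cell `χ_s(G/G_s × int(s))`. -/
def openCell (K : AbstractSimplicialGComplex G V) (s : K.faces) : Set K.Realization :=
  {y | ∃ z : (G ⧸ MulAction.stabilizer G s.1) × stdSimplex ℝ s.1,
    (∀ v, 0 < z.2.1 v) ∧ K.char s z = y}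

/-- The `p`-skeleton: the union of all open equivariant cells of dimension at most `p`, the
dimension of the cell of `s` being `s.card - 1`. -/
def skeleton (K : AbstractSimplicialGComplex G V) (p : ℤ) : Set K.Realization :=
  ⋃ s : {s : K.faces // (s.1.card : ℤ) - 1 ≤ p}, K.openCell s.1

theorem isGInvariant_subspaceOf (K L : AbstractSimplicialGComplex G V) :
    IsGInvariant G (K.subspaceOf L) := by
  rintro g _ ⟨s, hs, z, rfl⟩
  exact ⟨s, hs, _, (K.smul_char s g z).symm⟩

theorem isGInvariant_skeleton (K : AbstractSimplicialGComplex G V) (p : ℤ) :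
    IsGInvariant G (K.skeleton p) := by
  intro g y hy
  obtain ⟨s, z, hz, rfl⟩ := Set.mem_iUnion.1 hy
  exact Set.mem_iUnion.2 ⟨s, (g • z.1, z.2), hz, (K.smul_char s.1 g z).symm⟩

end AbstractSimplicialGComplex

section Pairs

open AbstractSimplicialGComplex

variable {G V : Type u} [Group G] [TopologicalSpace G] [ContinuousMul G] [LocallyCompactSpace G]
  [MulAction G V] [DecidableEq V]

/-- The pair `(X, A)` of simplicial `G`-complexes, where `X` is the realization of `K` and `A` is
the `G`-subspace of `X` that realizes the subcomplex `L ⊆ K`. -/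
noncomputable def simplicialPair (K L : AbstractSimplicialGComplex G V) (_hLK : L.faces ⊆ K.faces) :
    GPair.{u} G where
  carrier := K.Realization
  sub := K.subspaceOf L
  sub_inv := K.isGInvariant_subspaceOf L

/-- The skeletal filtration `X_p = X^p ∪ A` of a pair of simplicial `G`-complexes. -/
noncomputable def skeletalFiltration (K L : AbstractSimplicialGComplex G V) (hLK : L.faces ⊆ K.faces) :
    GFiltration (simplicialPair K L hLK) where
  level p := K.skeleton p ∪ K.subspaceOf L
  invariant p g y hy := hy.imp (K.isGInvariant_skeleton p g y) (K.isGInvariant_subspaceOf L g y)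
  mono p := Set.union_subset_union_left _ fun y hy => by
    obtain ⟨s, hs⟩ := Set.mem_iUnion.1 hy
    exact Set.mem_iUnion.2 ⟨⟨s.1, by have := s.2; omega⟩, hs⟩
  union := by
    refine Set.eq_univ_of_forall fun y => Set.mem_iUnion.2 ?_
    obtain ⟨x, hx, hxy⟩ := K.exists_simplexPoint y
    refine ⟨_, Or.inl (Set.mem_iUnion.2 ⟨⟨⟨_, y.support_mem⟩, le_rfl⟩, (QuotientGroup.mk 1, x), hx, ?_⟩)⟩
    rw [char_mk, one_smul, hxy]
  neg p hp := by
    refine Set.union_eq_right.2 fun y hy => ?_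
    obtain ⟨s, -⟩ := Set.mem_iUnion.1 hy
    have h1 := (K.isRelLowerSet_faces s.1.2).1.card_pos
    have h2 := s.2
    omega

end Pairs

/-! By the exact sequence of the triple `A ⊆ X_p ⊆ X`, it is enough that the homology of `(X, X_p)`
vanishes in degrees `n` and `n + 1`. This holds as soon as every cell outside `X_p` has dimension
`q` with `n + 1 - q ≤ n₀`, which leads to the bound `p ≥ n - n₀`.

By compact supports, a class of `(X, X_p)` comes from a compact `Y`. Such a `Y` meets only finitely
many equivariant open cells (`exists_finset_of_isCompact`): choosing one orbit in each cell that is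
met gives a family all of whose subunions are closed. So the class factors through `(|F'|, |F|)`,
where `|F| = X_p` and `F'` adds finitely many orbits of simplices. These orbits are attached one at
a time in order of dimension (`vanishes_of_finite_orbits`).

For a single orbit of a `q`-simplex `s` (`vanishes_addOrbit`), pushing radially away from the
barycenters shows that `|F|` may be enlarged to the punctured space without changing relative
homology. Excising `|F|` leaves the open cell, which is `G/G_s × (ℝ^q, ℝ^q ∖ 0)`. Its homology in
degree `k` vanishes if that of `G/G_s` does in degree `k - q`, by `q` relative suspensions
(`Vanishes.susp`).

Only the vanishing of groups is tracked, so one-sided retractions and the surjectivity half of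
excision are enough throughout. -/

namespace GPair

/-! ### Auxiliary pairs and inclusions -/

variable {G : Type u} [Group G] [TopologicalSpace G]

theorem hom_ext {P Q : GPair.{u} G} {f g : P ⟶ Q} (h : ∀ x, Hom.toFun f x = Hom.toFun g x) :
    f = g := Hom.ext (funext h)

/-- The `G`-pair `(X, Y)` on the space underlying a `G`-pair `(X, A)`. -/
def withSub (P : GPair.{u} G) (Y : Set P.carrier) (hY : IsGInvariant G Y) : GPair.{u} G where
  carrier := P.carrier
  sub := Y
  sub_inv := hY

/-- Allows `X_p`, given as skeleton together with `A`, to be replaced by its description in terms of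
supports. -/
theorem withSub_congr (P : GPair.{u} G) {Y Y' : Set P.carrier} (h : Y = Y')
    (hY : IsGInvariant G Y) (hY' : IsGInvariant G Y') : P.withSub Y hY = P.withSub Y' hY' := by
  subst h
  rfl

/-- The identity map `(X, A) → (X, Y)` for `A ⊆ Y`. -/
def toWithSub (P : GPair.{u} G) (Y : Set P.carrier) (hY : IsGInvariant G Y) (h : P.sub ⊆ Y) :
    P ⟶ P.withSub Y hY where
  toFun x := x
  continuous_toFun := continuous_id
  map_smul _ _ := rfl
  map_sub _ hx := h hx

theorem continuous_subpair_val (P : GPair.{u} G) (Y B : Set P.carrier) (hY : IsGInvariant G Y)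
    (hB : IsGInvariant G B) : Continuous fun y : (P.subpair Y B hY hB).carrier => y.1 :=
  continuous_subtype_val

/-- The inclusion of subpairs of a `G`-pair. -/
def subpairMap (P : GPair.{u} G) {Y B Y' B' : Set P.carrier} (hY : IsGInvariant G Y)
    (hB : IsGInvariant G B) (hY' : IsGInvariant G Y') (hB' : IsGInvariant G B')
    (h : Y ⊆ Y') (hb : B ⊆ B') : P.subpair Y B hY hB ⟶ P.subpair Y' B' hY' hB' where
  toFun y := ⟨y.1, h y.2⟩
  continuous_toFun := continuous_subtype_val.subtype_mk _
  map_smul _ _ := rfl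
  map_sub _ hx := hb hx

end GPair

/-! ### Vanishing of homology and the exact sequence of a triple -/

namespace EquivariantHomologyTheory

open GPair

variable {G : Type u} [Group G] [TopologicalSpace G] {R : Type v} [Ring R]
  (h : EquivariantHomologyTheory.{u, v, w} G R)

/-- The homology of the `G`-pair `P` vanishes in degree `n`. -/
def Vanishes (n : ℤ) (P : GPair.{u} G) : Prop := Subsingleton ((h.H n).obj P)

variable {h}

theorem map_comp_apply {P Q S : GPair.{u} G} (n : ℤ) (f : P ⟶ Q) (g : Q ⟶ S) (x : (h.H n).obj P) :
    ((h.H n).map (f ≫ g)).hom x = ((h.H n).map g).hom (((h.H n).map f).hom x) := by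
  rw [Functor.map_comp]; rfl

theorem map_id_apply {P : GPair.{u} G} (n : ℤ) (x : (h.H n).obj P) :
    ((h.H n).map (𝟙 P)).hom x = x := by
  rw [CategoryTheory.Functor.map_id]; rfl

theorem bd_naturality_apply {P Q : GPair.{u} G} (n : ℤ) (f : P ⟶ Q) (x : (h.H n).obj P) :
    ((h.bd n).app Q).hom (((h.H n).map f).hom x) =
      ((h.H (n - 1)).map ((restrict G).map f)).hom (((h.bd n).app P).hom x) := by
  have := congrArg (fun t => t.hom x) ((h.bd n).naturality f)
  exact this

theorem Vanishes.eq_zero {n : ℤ} {P : GPair.{u} G} (hP : h.Vanishes n P) (x : (h.H n).obj P) :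
    x = 0 :=
  haveI : Subsingleton ((h.H n).obj P) := hP
  Subsingleton.elim _ _

theorem vanishes_of_eq_zero {n : ℤ} {P : GPair.{u} G} (hP : ∀ x : (h.H n).obj P, x = 0) :
    h.Vanishes n P := ⟨fun x y => (hP x).trans (hP y).symm⟩

theorem Vanishes.of_homotopic {n : ℤ} {P Q : GPair.{u} G} (hQ : h.Vanishes n Q) (f : P ⟶ Q)
    (g : Q ⟶ P) (hfg : Homotopic (𝟙 P) (f ≫ g)) : h.Vanishes n P := by
  refine vanishes_of_eq_zero fun x => ?_
  rw [← map_id_apply n x, h.homotopy _ _ hfg, map_comp_apply, hQ.eq_zero (((h.H n).map f).hom x),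
    map_zero]

/-- The identity of `P` factors through `Q`. Besides genuine retracts, this serves to pass between
different presentations of the same pair, such as iterated subtypes. -/
theorem Vanishes.of_retract {n : ℤ} {P Q : GPair.{u} G} (hQ : h.Vanishes n Q) (f : P ⟶ Q)
    (g : Q ⟶ P) (hfg : ∀ x, Hom.toFun g (Hom.toFun f x) = x) : h.Vanishes n P := by
  refine vanishes_of_eq_zero fun x => ?_
  have : f ≫ g = 𝟙 P := hom_ext hfg
  rw [← map_id_apply n x, ← this, map_comp_apply, hQ.eq_zero (((h.H n).map f).hom x),
    map_zero]

/-- The inclusion `A → X` is an isomorphism of spaces, so the boundary map is zero by exactness, and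
every class of `H n (X)` comes from `A` and dies in the pair. -/
theorem vanishes_of_sub_eq_univ (n : ℤ) {P : GPair.{u} G} (hP : P.sub = Set.univ) :
    h.Vanishes n P := by
  let e : space G P.carrier ⟶ (restrict G).obj P :=
    { toFun := fun x => ⟨x, hP ▸ Set.mem_univ x⟩
      continuous_toFun := continuous_id.subtype_mk _
      map_smul := fun _ _ => rfl
      map_sub := fun _ hx => hx.elim }
  have he₁ : e ≫ P.inclSub = 𝟙 _ := hom_ext fun _ => rfl
  have he₂ : P.inclSub ≫ e = 𝟙 _ := hom_ext fun _ => rfl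
  refine vanishes_of_eq_zero fun x => ?_
  have hx : ((h.bd n).app P).hom x = 0 := by
    have h0 : ((h.H (n - 1)).map P.inclSub).hom (((h.bd n).app P).hom x) = 0 :=
      (h.exact_sub P n).apply_apply_eq_zero x
    rw [← map_id_apply (h := h) (n - 1) (((h.bd n).app P).hom x)]
    refine Eq.trans ?_ (map_zero ((h.H (n - 1)).map e).hom)
    rw [← h0, ← map_comp_apply, he₂]
  obtain ⟨z, rfl⟩ := (h.exact_pair P n x).1 hx
  rw [← map_id_apply n z, ← he₁, map_comp_apply]
  exact (h.exact_space P n).apply_apply_eq_zero _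

/-- A `G`-pair `(X, A)` has no homology if the identity is homotopic, as a map of pairs, to a map
with image in `A`. -/
theorem vanishes_of_compression (n : ℤ) {P : GPair.{u} G} (F : P.carrier × I → P.carrier)
    (hF : Continuous F) (hsmul : ∀ (g : G) (x : P.carrier) (t : I), F (g • x, t) = g • F (x, t))
    (hsub : ∀ x ∈ P.sub, ∀ t : I, F (x, t) ∈ P.sub) (h0 : ∀ x, F (x, 0) = x)
    (h1 : ∀ x, F (x, 1) ∈ P.sub) : h.Vanishes n P := by
  have hQ : h.Vanishes n (P.subpair P.sub P.sub P.sub_inv P.sub_inv) :=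
    vanishes_of_sub_eq_univ n (Set.eq_univ_of_forall fun x => x.2)
  refine hQ.of_homotopic
    { toFun := fun x => ⟨F (x, 1), h1 x⟩
      continuous_toFun := (hF.comp (by fun_prop)).subtype_mk _
      map_smul := fun g x => Subtype.ext (hsmul g x 1)
      map_sub := fun x _ => h1 x } (P.subpairIncl _ _ _ _ subset_rfl) ?_
  exact ⟨F, hF, hsmul, hsub, h0, fun _ => rfl⟩

section Triple

variable {P : GPair.{u} G} {Y : Set P.carrier} (hY : IsGInvariant G Y) (hPY : P.sub ⊆ Y)

/-- For `A ⊆ Y ⊆ X`, the space `A` is the subspace of the pair `(Y, A)`. -/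
def restrictToSubpair :
    (restrict G).obj P ⟶ (restrict G).obj (P.subpair Y P.sub hY P.sub_inv) where
  toFun a := ⟨⟨a.1, hPY a.2⟩, a.2⟩
  continuous_toFun := (continuous_subtype_val.subtype_mk _).subtype_mk _
  map_smul _ _ := rfl
  map_sub _ hx := hx.elim

/-- The identity of `Y`, as a map `(Y, ∅) → (Y, ∅)`. -/
def spaceToRestrict :
    space G (P.subpair Y P.sub hY P.sub_inv).carrier ⟶ (restrict G).obj (P.withSub Y hY) where
  toFun a := a
  continuous_toFun := continuous_id
  map_smul _ _ := rfl
  map_sub _ hx := hx.elim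

/-- The identity of `Y`, as a map `(Y, ∅) → (Y, ∅)`. -/
def restrictToSpace :
    (restrict G).obj (P.withSub Y hY) ⟶ space G (P.subpair Y P.sub hY P.sub_inv).carrier where
  toFun a := a
  continuous_toFun := continuous_id
  map_smul _ _ := rfl
  map_sub _ hx := hx.elim

-- The composite `(Y, A) → (X, Y)` factors through `(Y, Y)`, which has no homology.
include hPY in
theorem map_toWithSub_subpairIncl (n : ℤ) (y : (h.H n).obj (P.subpair Y P.sub hY P.sub_inv)) :
    ((h.H n).map (P.toWithSub Y hY hPY)).hom
      (((h.H n).map (P.subpairIncl Y P.sub hY P.sub_inv subset_rfl)).hom y) = 0 := by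
  let a : P.subpair Y P.sub hY P.sub_inv ⟶ P.subpair Y Y hY hY :=
    P.subpairMap hY P.sub_inv hY hY subset_rfl hPY
  let b : P.subpair Y Y hY hY ⟶ P.withSub Y hY :=
    (P.withSub Y hY).subpairIncl Y Y hY hY subset_rfl
  have hab : P.subpairIncl Y P.sub hY P.sub_inv subset_rfl ≫ P.toWithSub Y hY hPY = a ≫ b :=
    hom_ext fun _ => rfl
  have hv : h.Vanishes n (P.subpair Y Y hY hY) :=
    vanishes_of_sub_eq_univ n (Set.eq_univ_of_forall fun x => x.2)
  rw [← map_comp_apply, hab, map_comp_apply, hv.eq_zero (((h.H n).map a).hom y), map_zero]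

/-- Exactness of the sequence of the triple `A ⊆ Y ⊆ X` at `H n (X, A)`. -/
theorem exact_triple_total (n : ℤ) (x : (h.H n).obj P)
    (hx : ((h.H n).map (P.toWithSub Y hY hPY)).hom x = 0) :
    ∃ y, ((h.H n).map (P.subpairIncl Y P.sub hY P.sub_inv subset_rfl)).hom y = x := by
  set i := P.subpairIncl Y P.sub hY P.sub_inv subset_rfl
  set j := P.toWithSub Y hY hPY
  -- The boundary of `x` dies in `Y`, since its image there is the boundary of the image of `x` in
  -- `(X, Y)`, which is zero. Hence it is also the boundary of a class `y` of `(Y, A)`.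
  have h1 : ((h.H (n - 1)).map (P.subpair Y P.sub hY P.sub_inv).inclSub).hom
      (((h.H (n - 1)).map (restrictToSubpair hY hPY)).hom (((h.bd n).app P).hom x)) = 0 := by
    have e : restrictToSubpair hY hPY ≫ (P.subpair Y P.sub hY P.sub_inv).inclSub =
        (restrict G).map j ≫ restrictToSpace hY := hom_ext fun _ => rfl
    rw [← map_comp_apply, e, map_comp_apply]
    have := bd_naturality_apply n j x
    rw [hx, map_zero] at this
    rw [← map_zero ((h.H (n - 1)).map (restrictToSpace hY)).hom, this]
  obtain ⟨y, hy⟩ := (h.exact_sub _ n _).1 h1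
  -- The difference `x - y` has no boundary, so it comes from a class `z` of `X`; as `z` dies in
  -- `(X, Y)`, it comes from a class `w` of `Y`, which corrects `y`.
  have h2 : ((h.bd n).app P).hom (x - ((h.H n).map i).hom y) = 0 := by
    rw [map_sub, bd_naturality_apply, hy, ← map_comp_apply]
    have e : restrictToSubpair hY hPY ≫ (restrict G).map i = 𝟙 _ := hom_ext fun _ => rfl
    rw [e, map_id_apply]
    exact sub_self _
  obtain ⟨z, hz⟩ := (h.exact_pair P n _).1 h2
  have h3 : ((h.H n).map (P.withSub Y hY).inclSpace).hom z = 0 := by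
    have e : (P.withSub Y hY).inclSpace = P.inclSpace ≫ j := hom_ext fun _ => rfl
    rw [e]
    refine (map_comp_apply n P.inclSpace j z).trans ?_
    rw [hz, map_sub, hx, map_toWithSub_subpairIncl, sub_zero]
  obtain ⟨w, hw⟩ := (h.exact_space _ n _).1 h3
  refine ⟨y + ((h.H n).map (restrictToSpace hY ≫ (P.subpair Y P.sub hY P.sub_inv).inclSpace)).hom w,
    ?_⟩
  have e : (restrictToSpace hY ≫ (P.subpair Y P.sub hY P.sub_inv).inclSpace) ≫ i =
    (P.withSub Y hY).inclSub ≫ P.inclSpace := hom_ext fun _ => rfl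
  rw [map_add, ← map_comp_apply, e]
  have h4 := map_comp_apply n (P.withSub Y hY).inclSub P.inclSpace w
  rw [hw] at h4
  exact (congrArg _ (h4.trans hz)).trans (by abel)

include hPY in
/-- The sequence of the triple `A ⊆ Y ⊆ X` at `H (n - 1) (Y, A)`, if `H n (X, Y) = 0`. -/
theorem map_subpairIncl_injective {n : ℤ} (hQ : h.Vanishes n (P.withSub Y hY)) :
    Function.Injective
      ((h.H (n - 1)).map (P.subpairIncl Y P.sub hY P.sub_inv subset_rfl)).hom := by
  let S := P.subpair Y P.sub hY P.sub_inv
  let i : S ⟶ P := P.subpairIncl Y P.sub hY P.sub_inv subset_rfl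
  refine (injective_iff_map_eq_zero _).2 fun y hy => ?_
  -- The boundary maps of `(Y, A)` and `(X, A)` both land in the homology of `A`, so `y` has no
  -- boundary and lifts to a class `w` of `Y`.
  have h1 : ((h.bd (n - 1)).app (P.subpair Y P.sub hY P.sub_inv)).hom y = 0 := by
    have := bd_naturality_apply (n - 1) i y
    rw [hy, map_zero] at this
    have e : (restrict G).map i ≫ restrictToSubpair hY hPY = 𝟙 _ := hom_ext fun _ => rfl
    refine (map_id_apply (n - 1 - 1) _).symm.trans ?_
    rw [← e]
    refine (map_comp_apply _ ((restrict G).map i) (restrictToSubpair hY hPY) _).trans ?_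
    refine (congrArg _ this.symm).trans (map_zero _)
  obtain ⟨w, rfl⟩ := (h.exact_pair _ _ _).1 h1
  let c : space G S.carrier ⟶ space G P.carrier :=
    spaceToRestrict hY ≫ (P.withSub Y hY).inclSub
  have h2 : ((h.H (n - 1)).map P.inclSpace).hom (((h.H (n - 1)).map c).hom w) = 0 := by
    have e : c ≫ P.inclSpace = S.inclSpace ≫ i := hom_ext fun _ => rfl
    rw [← map_comp_apply, e, map_comp_apply, hy]
  obtain ⟨a, ha⟩ := (h.exact_space P _ _).1 h2
  set a' := ((h.H (n - 1)).map (restrictToSubpair hY hPY ≫ S.inclSub)).hom a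
  -- In `X` the class `w` agrees with one coming from `A`. The difference `w - a'` therefore is a
  -- boundary from `(X, Y)`, hence zero, and `w` dies in `(Y, A)`.
  have h3 : ((h.H (n - 1)).map (P.withSub Y hY).inclSub).hom
      (((h.H (n - 1)).map (spaceToRestrict hY)).hom (w - a')) = 0 := by
    refine (map_comp_apply _ (spaceToRestrict hY) (P.withSub Y hY).inclSub _).symm.trans ?_
    have e : (restrictToSubpair hY hPY ≫ S.inclSub) ≫ c = P.inclSub := hom_ext fun _ => rfl
    have h4 : ((h.H (n - 1)).map c).hom a' = ((h.H (n - 1)).map c).hom w := by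
      rw [← ha, ← e]
      exact (map_comp_apply _ _ _ _).symm
    exact (map_sub ((h.H (n - 1)).map c).hom _ _).trans (by rw [h4]; exact sub_self _)
  obtain ⟨q, hq⟩ := (h.exact_sub (P.withSub Y hY) n _).1 h3
  rw [hQ.eq_zero q, map_zero] at hq
  have h5 : w - a' = 0 := by
    have e : spaceToRestrict hY ≫ restrictToSpace hY = 𝟙 _ := hom_ext fun _ => rfl
    refine (map_id_apply _ _).symm.trans ?_
    rw [← e]
    refine (map_comp_apply _ (spaceToRestrict hY) (restrictToSpace hY) _).trans ?_
    exact (congrArg _ hq.symm).trans (map_zero _)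
  rw [sub_eq_zero.1 h5]
  have h6 : a' = ((h.H (n - 1)).map S.inclSub).hom
    (((h.H (n - 1)).map (restrictToSubpair hY hPY)).hom a) := map_comp_apply _ _ _ _
  rw [h6]
  exact (h.exact_space S _).apply_apply_eq_zero _

-- Exactness at `H n (X, Y)`, between `H n (X, A)` and `H (n - 1) (Y, A)`. The boundary `d` of a
-- class of `(X, Y)` dies in `(Y, A)`, so it comes from `A`; that class of `A` dies in `X`, so it is
-- a boundary from `(X, A)` and vanishes. Then the given class comes from `X` and factors through
-- `(X, A)`.
include hPY in
theorem Vanishes.withSub {n : ℤ} (hP : h.Vanishes n P)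
    (hS : h.Vanishes (n - 1) (P.subpair Y P.sub hY P.sub_inv)) :
    h.Vanishes n (P.withSub Y hY) := by
  set S := P.subpair Y P.sub hY P.sub_inv
  refine vanishes_of_eq_zero fun x => ?_
  set d := ((h.bd n).app (P.withSub Y hY)).hom x with hd
  obtain ⟨a, ha⟩ := (h.exact_space S (n - 1) (((h.H (n - 1)).map (restrictToSpace hY)).hom d)).1
    (hS.eq_zero _)
  have e₁ : restrictToSpace hY ≫ spaceToRestrict hY = 𝟙 ((restrict G).obj (P.withSub Y hY)) :=
    hom_ext fun _ => rfl
  let r : (restrict G).obj S ⟶ (restrict G).obj P :=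
    (restrict G).map (P.subpairIncl Y P.sub hY P.sub_inv subset_rfl)
  let j := (restrict G).map (P.toWithSub Y hY hPY)
  have h1 : ((h.H (n - 1)).map j).hom (((h.H (n - 1)).map r).hom a) = d := by
    have e : r ≫ j = S.inclSub ≫ spaceToRestrict hY := hom_ext fun _ => rfl
    rw [← map_comp_apply, e, map_comp_apply, ha, ← map_comp_apply, e₁]
    exact map_id_apply _ d
  have h2 : ((h.H (n - 1)).map P.inclSub).hom (((h.H (n - 1)).map r).hom a) = 0 := by
    have e : P.inclSub = j ≫ (P.withSub Y hY).inclSub := hom_ext fun _ => rfl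
    rw [e]
    refine (map_comp_apply _ j (P.withSub Y hY).inclSub _).trans ?_
    rw [h1]
    exact (h.exact_sub _ n).apply_apply_eq_zero x
  obtain ⟨c, hc⟩ := (h.exact_sub P n _).1 h2
  rw [hP.eq_zero c, map_zero] at hc
  have h3 : d = 0 := by rw [← h1, ← hc]; exact map_zero _
  obtain ⟨z, rfl⟩ := (h.exact_pair _ n x).1 h3
  have e : (P.withSub Y hY).inclSpace = P.inclSpace ≫ P.toWithSub Y hY hPY :=
    hom_ext fun _ => rfl
  rw [e]
  refine (map_comp_apply n P.inclSpace (P.toWithSub Y hY hPY) z).trans ?_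
  rw [hP.eq_zero (((h.H n).map P.inclSpace).hom z), map_zero]

include hPY in
theorem Vanishes.of_triple {n : ℤ} (hQ : h.Vanishes n (P.withSub Y hY))
    (hS : h.Vanishes n (P.subpair Y P.sub hY P.sub_inv)) : h.Vanishes n P := by
  refine vanishes_of_eq_zero fun x => ?_
  obtain ⟨y, rfl⟩ := exact_triple_total hY hPY n x (hQ.eq_zero _)
  rw [hS.eq_zero y, map_zero]

end Triple

/-- A version of `Vanishes.of_triple` for subspaces `B ⊆ Y ⊆ Z` of a `G`-space. -/
theorem Vanishes.trans {n : ℤ} {P : GPair.{u} G} {B Y Z : Set P.carrier}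
    {hB : IsGInvariant G B} {hY : IsGInvariant G Y} {hZ : IsGInvariant G Z}
    (hBY : B ⊆ Y) (hYZ : Y ⊆ Z)
    (h₁ : h.Vanishes n (P.subpair Z Y hZ hY)) (h₂ : h.Vanishes n (P.subpair Y B hY hB)) :
    h.Vanishes n (P.subpair Z B hZ hB) := by
  have hY' : IsGInvariant G {z : (P.subpair Z B hZ hB).carrier | z.1 ∈ Y} :=
    fun g x hx => hY g x.1 hx
  refine Vanishes.of_triple (P := P.subpair Z B hZ hB) hY' (fun x hx => hBY hx) h₁ ?_
  exact h₂.of_retract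
    { toFun := fun y => ⟨y.1.1, y.2⟩
      continuous_toFun := ((P.continuous_subpair_val Z B hZ hB).comp
        ((P.subpair Z B hZ hB).continuous_subpair_val _ _ hY' (GPair.sub_inv _))).subtype_mk _
      map_smul := fun _ _ => rfl
      map_sub := fun _ hx => hx }
    { toFun := fun y => ⟨⟨y.1, hYZ y.2⟩, y.2⟩
      continuous_toFun := (continuous_subtype_val.subtype_mk _).subtype_mk _
      map_smul := fun _ _ => rfl
      map_sub := fun _ hx => hx } fun _ => rfl

theorem Vanishes.of_excision {n : ℤ} {P : GPair.{u} G} {U : Set P.carrier}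
    (hU : IsGInvariant G U) (hUP : closure U ⊆ interior P.sub)
    (hP : h.Vanishes n (P.subpair Uᶜ (P.sub \ U) (isGInvariant_compl hU)
      (isGInvariant_diff P.sub_inv hU))) : h.Vanishes n P := by
  have := h.excision P U hU hUP n
  refine vanishes_of_eq_zero fun x => ?_
  obtain ⟨y, rfl⟩ := (ConcreteCategory.bijective_of_isIso ((h.H n).map (P.subpairIncl Uᶜ (P.sub \ U)
    (isGInvariant_compl hU) (isGInvariant_diff P.sub_inv hU) Set.sdiff_subset))).2 x
  rw [hP.eq_zero y]
  exact map_zero _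

end EquivariantHomologyTheory

/-! ### Relative suspension and products with Euclidean space -/

namespace GPair

variable {G : Type u} [Group G] [TopologicalSpace G]

/-- The action on a product with a space on which `G` acts trivially. -/
@[reducible]
def prodTrivialAct (B : Type u) [MulAction G B] (E : Type) : MulAction G (B × E) where
  smul g z := (g • z.1, z.2)
  one_smul z := Prod.ext (one_smul G z.1) rfl
  mul_smul g k z := Prod.ext (mul_smul g k z.1) rfl

/-- The pair `(B × E, S)`, where `G` acts on the first factor only. -/
def prodTrivial (B : Type u) [TopologicalSpace B] [MulAction G B] [ContinuousSMul G B]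
    (E : Type) [TopologicalSpace E] (S : Set (B × E))
    (hS : ∀ (g : G) (b : B) (x : E), (b, x) ∈ S → (g • b, x) ∈ S) : GPair.{u} G :=
  letI : MulAction G (B × E) := prodTrivialAct B E
  { carrier := B × E
    cont := ⟨by
      change Continuous fun z : G × (B × E) => (z.1 • z.2.1, z.2.2)
      fun_prop⟩
    sub := S
    sub_inv := fun g z hz => hS g z.1 z.2 hz }

/-- The relative suspension `(X, A) × (ℝ, ℝ ∖ 0)` of a pair. -/
def susp (P : GPair.{u} G) : GPair.{u} G :=
  prodTrivial P.carrier ℝ {z | z.1 ∈ P.sub ∨ z.2 ≠ 0}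
    fun g b _ h => h.imp (P.sub_inv g b) id

/-- The pair `B × (ℝᵖ, ℝᵖ ∖ 0)`. -/
def prodEuclidean (B : Type u) [TopologicalSpace B] [MulAction G B] [ContinuousSMul G B]
    (p : ℕ) : GPair.{u} G :=
  prodTrivial B (Fin p → ℝ) {z | z.2 ≠ 0} fun _ _ _ h => h

end GPair

namespace EquivariantHomologyTheory

open GPair

variable {G : Type u} [Group G] [TopologicalSpace G] {R : Type v} [Ring R]
  {h : EquivariantHomologyTheory.{u, v, w} G R}

/-- The triple `A × ℝ ∪ X × (0, ∞) ⊆ A × ℝ ∪ X × (ℝ ∖ 0) ⊆ X × ℝ` is used. The outer pair is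
contractible upwards, and the pair of the two smaller sets reduces by excision to its lower half, a
copy of `(X, A)`, which accounts for the degree shift. -/
theorem Vanishes.susp {n : ℤ} {P : GPair.{u} G} (hC : IsOpen P.sub)
    (hP : h.Vanishes (n - 1) P) : h.Vanishes n P.susp := by
  let T : GPair.{u} G := prodTrivial P.carrier ℝ {z | z.1 ∈ P.sub ∨ 0 < z.2}
    fun g b _ h => h.imp (P.sub_inv g b) id
  have hT : h.Vanishes n T := by
    -- Adding a multiple of `1 + |t|` makes every height positive at time `1` and never lowers a
    -- height.
    refine vanishes_of_compression n (P := T) (fun z => (z.1.1, z.1.2 + z.2 * (1 + |z.1.2|)))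
      ?_ (fun _ _ _ => rfl) ?_ ?_ ?_
    · change Continuous fun z : (P.carrier × ℝ) × I => (z.1.1, z.1.2 + (z.2 : ℝ) * (1 + |z.1.2|))
      fun_prop
    · rintro ⟨y, t⟩ hx s
      refine hx.imp id fun ht => ?_
      have := s.2.1
      change 0 < t at ht
      change 0 < t + s * (1 + |t|)
      positivity
    · rintro ⟨y, t⟩
      exact Prod.ext rfl (by simp)
    · rintro ⟨y, t⟩
      refine Or.inr ?_
      change 0 < t + ((1 : I) : ℝ) * (1 + |t|)
      have := neg_abs_le t
      simp only [Set.Icc.coe_one, one_mul]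
      linarith
  have hsub : T.sub ⊆ P.susp.sub := fun z hz => hz.imp id fun ht => ne_of_gt ht
  refine hT.withSub (P := T) (Y := P.susp.sub) P.susp.sub_inv hsub ?_
  let Q := T.subpair P.susp.sub T.sub P.susp.sub_inv T.sub_inv
  have hfst : Continuous fun z : Q.carrier => z.1.1 :=
    continuous_fst.comp (continuous_subtype_val (X := P.carrier × ℝ))
  have hsnd : Continuous fun z : Q.carrier => z.1.2 :=
    continuous_snd.comp (continuous_subtype_val (X := P.carrier × ℝ))
  -- The upper half over `X ∖ A` is excised. It is closed because `A` is open and height `0` does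
  -- not occur over `X ∖ A`.
  let U : Set Q.carrier := {z | z.1.1 ∉ P.sub ∧ 0 < z.1.2}
  have hU : IsGInvariant G U := fun g z hz =>
    ⟨fun h' => hz.1 (inv_smul_smul g z.1.1 ▸ P.sub_inv g⁻¹ _ h'), hz.2⟩
  have hUc : IsClosed U := by
    have : U = {z : Q.carrier | z.1.1 ∈ P.subᶜ} ∩ {z : Q.carrier | 0 ≤ z.1.2} := by
      ext z
      refine ⟨fun hz => ⟨hz.1, hz.2.le⟩, fun hz => ⟨hz.1, lt_of_le_of_ne hz.2 ?_⟩⟩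
      exact ((z.2 : z.1.1 ∈ P.sub ∨ z.1.2 ≠ 0).resolve_left hz.1).symm
    rw [this]
    exact (hC.isClosed_compl.preimage hfst).inter (isClosed_le continuous_const hsnd)
  have hQo : IsOpen Q.sub :=
    (hC.preimage hfst).union (isOpen_lt continuous_const hsnd)
  refine Vanishes.of_excision (P := Q) hU ?_ ?_
  · rw [hUc.closure_eq, hQo.interior_eq]
    exact fun z hz => Or.inr hz.2
  let Q' := Q.subpair Uᶜ (Q.sub \ U) (isGInvariant_compl hU) (isGInvariant_diff Q.sub_inv hU)
  have hval : Continuous fun z : Q'.carrier => z.1 := continuous_subpair_val Q _ _ _ _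
  have hQ'sub : ∀ z : Q'.carrier, z ∈ Q'.sub ↔ z.1.1.1 ∈ P.sub := by
    refine fun z => ⟨fun hz => ?_, fun hz => ⟨Or.inl hz, fun h' => h'.1 hz⟩⟩
    by_contra hn
    exact hz.2 ⟨hn, (hz.1 : z.1.1.1 ∈ P.sub ∨ 0 < z.1.1.2).resolve_left hn⟩
  have hneg : ∀ (z : Q'.carrier), z.1.1.1 ∉ P.sub → z.1.1.2 < 0 := fun z hz =>
    lt_of_le_of_ne (not_lt.1 fun h' => z.2 ⟨hz, h'⟩)
      ((z.1.2 : z.1.1.1 ∈ P.sub ∨ z.1.1.2 ≠ 0).resolve_left hz)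
  -- What remains is `A × ℝ ∪ (X ∖ A) × (-∞, 0)` relative to `A × ℝ`. A straight-line homotopy moves
  -- it to height `-1`, staying negative over `X ∖ A`.
  let g : P ⟶ Q' :=
    { toFun := fun y => ⟨⟨(y, -1), Or.inr (by norm_num)⟩, fun h' => by
        have : (0 : ℝ) < -1 := h'.2
        norm_num at this⟩
      continuous_toFun := Continuous.subtype_mk (Continuous.subtype_mk (by fun_prop) _) _
      map_smul := fun _ _ => rfl
      map_sub := fun y hy => (hQ'sub _).2 hy }
  let f : Q' ⟶ P :=
    { toFun := fun z => z.1.1.1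
      continuous_toFun := hfst.comp hval
      map_smul := fun _ _ => rfl
      map_sub := fun y hy => (hQ'sub _).1 hy }
  refine hP.of_homotopic f g ?_
  have hlt : ∀ (z : Q'.carrier) (s : I), z.1.1.1 ∉ P.sub →
      (1 - (s : ℝ)) * z.1.1.2 + s * (-1) < 0 := by
    intro z s hz
    have := hneg z hz
    have h0 := s.2.1
    have h1 := s.2.2
    rcases eq_or_lt_of_le h0 with h | h
    · rw [← h]; linarith
    · nlinarith
  refine ⟨fun z => ⟨⟨((z.1.1.1.1, (1 - (z.2 : ℝ)) * z.1.1.1.2 + z.2 * (-1)) : P.carrier × ℝ), ?_⟩,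
    ?_⟩, ?_, ?_, ?_, ?_, ?_⟩
  · by_cases hz : z.1.1.1.1 ∈ P.sub
    · exact Or.inl hz
    · exact Or.inr (hlt z.1 z.2 hz).ne
  · exact fun h' => lt_asymm h'.2 (hlt z.1 z.2 h'.1)
  · refine Continuous.subtype_mk (Continuous.subtype_mk ?_ _) _
    have h1 : Continuous fun z : Q'.carrier × I => z.1.1.1.1 :=
      (hfst.comp hval).comp continuous_fst
    have h2 : Continuous fun z : Q'.carrier × I => z.1.1.1.2 :=
      (hsnd.comp hval).comp continuous_fst
    have h3 : Continuous fun z : Q'.carrier × I => (z.2 : ℝ) :=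
      continuous_subtype_val.comp continuous_snd
    exact h1.prodMk (((continuous_const.sub h3).mul h2).add (h3.mul continuous_const))
  · exact fun _ _ _ => rfl
  · exact fun x hx t => (hQ'sub _).2 ((hQ'sub x).1 hx)
  · intro x
    refine Subtype.ext (Subtype.ext (Prod.ext (α := P.carrier) (β := ℝ) rfl ?_))
    change (1 - ((0 : I) : ℝ)) * x.1.1.2 + ((0 : I) : ℝ) * (-1) = x.1.1.2
    simp
  · intro x
    refine Subtype.ext (Subtype.ext (Prod.ext (α := P.carrier) (β := ℝ) rfl ?_))
    change (1 - ((1 : I) : ℝ)) * x.1.1.2 + ((1 : I) : ℝ) * (-1) = -1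
    simp

/-- Splitting off coordinate `0` identifies `B × (ℝ^(p+1), ℝ^(p+1) ∖ 0)` with the relative
suspension of `B × (ℝ^p, ℝ^p ∖ 0)`. For `p = 0` the complement of the origin is empty. -/
theorem Vanishes.prodEuclidean {B : Type u} [TopologicalSpace B] [MulAction G B]
    [ContinuousSMul G B] (p : ℕ) {n : ℤ} (hB : h.Vanishes (n - p) (space G B)) :
    h.Vanishes n (prodEuclidean (G := G) B p) := by
  induction p generalizing n with
  | zero =>
    rw [Nat.cast_zero, sub_zero] at hB
    exact hB.of_retract
      { toFun := fun z => z.1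
        continuous_toFun := continuous_fst
        map_smul := fun _ _ => rfl
        map_sub := fun z hz => (hz (Subsingleton.elim _ _)).elim }
      { toFun := fun b => (b, 0)
        continuous_toFun := by
          change Continuous fun b : B => (b, (0 : Fin 0 → ℝ))
          fun_prop
        map_smul := fun _ _ => rfl
        map_sub := fun z hz => hz.elim } fun z => Prod.ext rfl (Subsingleton.elim _ _)
  | succ p ih =>
    have h1 : h.Vanishes (n - 1) (GPair.prodEuclidean (G := G) B p) := by
      refine ih ?_
      convert hB using 1
      push_cast
      ring
    have hopen : IsOpen (GPair.prodEuclidean (G := G) B p).sub :=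
      (isClosed_singleton (x := (0 : Fin p → ℝ))).isOpen_compl.preimage
        (continuous_snd (X := B))
    refine (h1.susp hopen).of_retract
      { toFun := fun z => ((z.1, Fin.tail z.2), z.2 0)
        continuous_toFun := by
          change Continuous fun z : B × (Fin (p + 1) → ℝ) => ((z.1, Fin.tail z.2), z.2 0)
          unfold Fin.tail
          fun_prop
        map_smul := fun _ _ => rfl
        map_sub := fun z hz => ?_ }
      { toFun := fun z => (z.1.1, Fin.cons z.2 z.1.2)
        continuous_toFun := by
          change Continuous fun z : (B × (Fin p → ℝ)) × ℝ =>
            (z.1.1, (Fin.cons z.2 z.1.2 : Fin (p + 1) → ℝ))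
          refine Continuous.prodMk (by fun_prop) (continuous_pi fun i => ?_)
          refine Fin.cases ?_ (fun j => ?_) i
          · simp only [Fin.cons_zero]; fun_prop
          · simp only [Fin.cons_succ]; fun_prop
        map_smul := fun _ _ => rfl
        map_sub := fun z hz h0 => ?_ } fun z => Prod.ext rfl (Fin.cons_self_tail _)
    · by_contra hn
      obtain ⟨h2, h3⟩ := not_or.1 hn
      refine hz (funext fun i => ?_)
      refine Fin.cases (not_not.1 h3) (fun j => congrFun (not_not.1 h2) j) i
    · refine hz.elim (fun h' => h' (funext fun j => ?_)) fun h' => h' ?_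
      · exact congrFun h0 j.succ
      · exact congrFun h0 0

end EquivariantHomologyTheory

/-! ### Subcomplexes and the topology of the realization -/

namespace AbstractSimplicialGComplex

variable {G V : Type*} [Group G] [MulAction G V] [DecidableEq V]

/-- A set of simplices of `K` that is closed under passing to faces and under the action. -/
structure IsSubcomplex (K : AbstractSimplicialGComplex G V) (F : Set (Finset V)) : Prop where
  subset : F ⊆ K.faces
  lower : ∀ s ∈ F, ∀ t ⊆ s, t.Nonempty → t ∈ F
  smul : ∀ g : G, ∀ s ∈ F, g • s ∈ F

/-- The subspace of the realization formed by the open cells of the simplices in `F`. -/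
def geom (K : AbstractSimplicialGComplex G V) (F : Set (Finset V)) : Set K.Realization :=
  {y | y.coords.support ∈ F}

variable {K : AbstractSimplicialGComplex G V} {F : Set (Finset V)}

theorem IsSubcomplex.smul_mem_iff (hF : K.IsSubcomplex F) (g : G) (s : Finset V) :
    g • s ∈ F ↔ s ∈ F :=
  ⟨fun h => by simpa using hF.smul g⁻¹ _ h, hF.smul g s⟩

theorem support_smul (g : G) (y : K.Realization) :
    (g • y).coords.support = g • y.coords.support := by
  rw [coords_smul, support_mapDomain_smul]

theorem smul_apply (g : G) (y : K.Realization) (v : V) :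
    (g • y).coords v = y.coords (g⁻¹ • v) := by
  rw [coords_smul, mapDomain_smul_apply]

theorem isGInvariant_geom (hF : K.IsSubcomplex F) : IsGInvariant G (K.geom F) :=
  fun g y hy => by
    change (g • y).coords.support ∈ F
    rw [support_smul]
    exact hF.smul g _ hy

theorem support_simplexPoint_subset (t : K.faces) (x : stdSimplex ℝ t.1) :
    (K.simplexPoint t x).coords.support ⊆ t.1 := support_extend_subset x

theorem support_nonempty (y : K.Realization) : y.coords.support.Nonempty :=
  (K.isRelLowerSet_faces y.support_mem).1

theorem simplexPoint_apply (t : K.faces) (x : stdSimplex ℝ t.1) (v : t.1) :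
    (K.simplexPoint t x).coords v = x.1 v := by
  change extend x v = _
  rw [extend_apply, dif_pos v.2]

theorem simplexPoint_injective (t : K.faces) : Function.Injective (K.simplexPoint t) := by
  intro x y hxy
  refine Subtype.ext (funext fun v => ?_)
  rw [← simplexPoint_apply, ← simplexPoint_apply, hxy]

/-- Preimages of invariant sets under a characteristic map are of the form `G/G_t × C'`, so
membership is decided on the simplex alone. -/
theorem char_mem_iff {C : Set K.Realization} (hC : IsGInvariant G C) (t : K.faces)
    (z : (G ⧸ MulAction.stabilizer G t.1) × stdSimplex ℝ t.1) :
    K.char t z ∈ C ↔ K.simplexPoint t z.2 ∈ C := by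
  obtain ⟨c, x⟩ := z
  induction c using QuotientGroup.induction_on with
  | H a =>
    rw [char_mk]
    exact ⟨fun h => by simpa using hC a⁻¹ _ h, hC a _⟩

theorem char_mem_geom (hF : K.IsSubcomplex F) (t : K.faces) (ht : t.1 ∈ F)
    (z : (G ⧸ MulAction.stabilizer G t.1) × stdSimplex ℝ t.1) : K.char t z ∈ K.geom F :=
  (char_mem_iff (isGInvariant_geom hF) t z).2 (hF.lower _ ht _ (support_simplexPoint_subset t _)
    (support_nonempty _))

/-- The point of the simplex `t` with the coordinates of `y`. -/
def toSimplex (t : Finset V) (y : K.Realization) (hy : y.coords.support ⊆ t) : stdSimplex ℝ t :=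
  ⟨fun v => y.coords v.1, fun v => y.nonneg _, by
    rw [Finset.sum_coe_sort t y.coords, ← Finsupp.sum_of_support_subset _ hy (fun _ a => a)
      (fun _ _ => rfl)]
    exact y.sum_eq⟩

theorem simplexPoint_toSimplex (t : K.faces) (y : K.Realization) (hy : y.coords.support ⊆ t.1) :
    K.simplexPoint t (toSimplex t.1 y hy) = y := by
  apply Realization.ext
  ext v
  by_cases hv : v ∈ t.1
  · exact simplexPoint_apply t _ ⟨v, hv⟩
  · rw [Finsupp.notMem_support_iff.1 fun h => hv (hy h),
      Finsupp.notMem_support_iff.1 fun h => hv (support_simplexPoint_subset t _ h)]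

/-- The inclusion of a face of a simplex. -/
noncomputable def faceIncl {s : Finset V} (t : Finset V) (h : s ⊆ t) (x : stdSimplex ℝ s) :
    stdSimplex ℝ t :=
  ⟨fun v => extend x v.1, fun v => by
    change 0 ≤ extend x v.1
    rw [extend_apply]; split_ifs; exacts [x.2.1 _, le_rfl], by
    rw [Finset.sum_coe_sort t (extend x), ← Finsupp.sum_of_support_subset _
      ((support_extend_subset x).trans h) (fun _ a => a) (fun _ _ => rfl)]
    exact sum_extend x⟩

theorem simplexPoint_faceIncl (s t : K.faces) (h : s.1 ⊆ t.1) (x : stdSimplex ℝ s.1) :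
    K.simplexPoint t (faceIncl t.1 h x) = K.simplexPoint s x :=
  simplexPoint_toSimplex t (K.simplexPoint s x) ((support_extend_subset x).trans h)

theorem continuous_faceIncl {s t : Finset V} (h : s ⊆ t) : Continuous (faceIncl t h) := by
  refine Continuous.subtype_mk (continuous_pi fun v => ?_) _
  simp only [extend_apply]
  split_ifs
  · exact (continuous_apply _).comp continuous_subtype_val
  · exact continuous_const

theorem isClosedEmbedding_faceIncl {s t : Finset V} (h : s ⊆ t) :
    IsClosedEmbedding (faceIncl t h) := by
  refine (continuous_faceIncl h).isClosedEmbedding fun x y hxy => Subtype.ext (funext fun v => ?_)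
  have := congrFun (congrArg Subtype.val hxy) ⟨v.1, h v.2⟩
  change extend x v.1 = extend y v.1 at this
  rwa [extend_apply, extend_apply, dif_pos v.2, dif_pos v.2] at this

/-- An element that stabilizes `t` fixes all vertices of `t`, in particular those of `s`. -/
theorem stabilizer_le {s t : Finset V} (ht : t ∈ K.faces) (h : s ⊆ t) :
    MulAction.stabilizer G t ≤ MulAction.stabilizer G s := by
  intro g hg
  rw [MulAction.mem_stabilizer_iff] at hg ⊢
  have hfix := K.fixed t ht g hg
  ext v
  rw [Finset.mem_smul_finset]
  constructor
  · rintro ⟨w, hw, rfl⟩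
    rwa [hfix w (h hw)]
  · exact fun hv => ⟨v, hv, hfix v (h hv)⟩

theorem char_faceIncl (s t : K.faces) (h : s.1 ⊆ t.1) (c : G ⧸ MulAction.stabilizer G t.1)
    (x : stdSimplex ℝ s.1) : K.char t (c, faceIncl t.1 h x) =
      K.char s (Subgroup.quotientMapOfLE (stabilizer_le t.2 h) c, x) := by
  induction c using QuotientGroup.induction_on with
  | H a =>
    rw [char_mk, simplexPoint_faceIncl s t h]
    rfl

section Topology

variable [TopologicalSpace G]

theorem continuous_char (s : K.faces) : Continuous (K.char s) :=
  continuous_def.2 fun U hU => (K.isOpen_iff U).1 hU s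

theorem isClosed_iff_char (C : Set K.Realization) :
    IsClosed C ↔ ∀ s : K.faces, IsClosed (K.char s ⁻¹' C) := by
  simp only [← isOpen_compl_iff, K.isOpen_iff, Set.preimage_compl]

/-- A simplex `u` outside `F` meets `|F|` in finitely many faces. The preimage of `C` in the cell of
`u` is thus a finite union of images, under closed face inclusions, of pullbacks of its preimages in
cells of `F`. -/
theorem isClosed_of_isClosed_char (hF : K.IsSubcomplex F) {C : Set K.Realization}
    (hCF : C ⊆ K.geom F) (hC : ∀ t : K.faces, t.1 ∈ F → IsClosed (K.char t ⁻¹' C)) :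
    IsClosed C := by
  refine (isClosed_iff_char C).2 fun u => ?_
  have key : K.char u ⁻¹' C = ⋃ t ∈ {t : K.faces | t.1 ∈ F ∧ t.1 ⊆ u.1}, ⋃ h : t.1 ⊆ u.1,
      Prod.map id (faceIncl u.1 h) ''
        (Prod.map (Subgroup.quotientMapOfLE (stabilizer_le u.2 h)) id ⁻¹' (K.char t ⁻¹' C)) := by
    ext ⟨c, x⟩
    simp only [Set.mem_preimage, Set.mem_iUnion, Set.mem_image]
    constructor
    · intro hx
      have hxF : (K.simplexPoint u x).coords.support ∈ F := by
        have := hCF hx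
        exact (char_mem_iff (isGInvariant_geom hF) u (c, x)).1 this
      have hsub := support_simplexPoint_subset u x
      -- A point of `C` in the cell of `u` is covered by the face spanned by its support, which
      -- belongs to `F` since `C ⊆ |F|`.
      let t : K.faces := ⟨_, (K.simplexPoint u x).support_mem⟩
      have hx' : faceIncl u.1 hsub (toSimplex t.1 (K.simplexPoint u x) subset_rfl) = x := by
        apply simplexPoint_injective
        rw [simplexPoint_faceIncl t u, simplexPoint_toSimplex t]
      refine ⟨t, ⟨hxF, hsub⟩, hsub, (c, toSimplex t.1 (K.simplexPoint u x) subset_rfl), ?_,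
        Prod.ext rfl hx'⟩
      rw [Prod.map_apply, ← char_faceIncl t u hsub, id, hx']
      exact hx
    · rintro ⟨t, -, h, ⟨c', x'⟩, hz, hzx⟩
      rw [← hzx, Prod.map_apply, id, char_faceIncl t u h]
      exact hz
  rw [key]
  refine Set.Finite.isClosed_biUnion ?_ fun t ht => isClosed_iUnion_of_finite fun h => ?_
  · refine Set.Finite.subset (Set.Finite.preimage (f := fun t : K.faces => t.1)
      (Subtype.val_injective.injOn) (u.1.powerset.finite_toSet)) fun t ht => ?_
    exact Finset.mem_coe.2 (Finset.mem_powerset.2 ht.2)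
  · refine (IsClosedEmbedding.id.prodMap (isClosedEmbedding_faceIncl h)).isClosedMap _ ?_
    refine (hC t ht.1).preimage (Continuous.prodMap ?_ continuous_id)
    exact isQuotientMap_quotient_mk'.continuous_iff.2 QuotientGroup.continuous_mk

theorem isClosed_geom (hF : K.IsSubcomplex F) : IsClosed (K.geom F) := by
  refine isClosed_of_isClosed_char hF subset_rfl fun t ht => ?_
  convert isClosed_univ
  exact Set.eq_univ_of_forall fun z => char_mem_geom hF t ht z

/-- The topology of a subcomplex is coherent with respect to its closed cells. -/
theorem isOpen_of_isOpen_char (hF : K.IsSubcomplex F) {U : Set K.Realization}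
    (hUF : U ⊆ K.geom F) {O : Set U}
    (hO : ∀ t : K.faces, t.1 ∈ F → IsOpen (K.char t ⁻¹' (Subtype.val '' O))) : IsOpen O := by
  have hC : IsClosed (K.geom F \ Subtype.val '' O) := by
    refine isClosed_of_isClosed_char hF Set.sdiff_subset fun t ht => ?_
    convert (hO t ht).isClosed_compl using 1
    ext z
    exact ⟨fun h => h.2, fun h => ⟨char_mem_geom hF t ht z, h⟩⟩
  convert hC.isOpen_compl.preimage (continuous_subtype_val (p := (· ∈ U))) using 1
  ext y
  simp only [Set.mem_preimage, Set.mem_compl_iff, Set.mem_sdiff, not_and, not_not]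
  constructor
  · exact fun hy _ => ⟨y, hy, rfl⟩
  · intro hy
    obtain ⟨y', hy', e⟩ := hy (hUF y.2)
    rwa [← Subtype.ext e]

/-- A quotient map restricts to a quotient map over an open subset. This gives continuity criteria
on the punctured space and on the difference of two subcomplexes. -/
theorem isQuotientMap_char_restrict (hF : K.IsSubcomplex F) {U : Set K.Realization}
    (hUF : U ⊆ K.geom F) (hU : ∀ t : K.faces, t.1 ∈ F → IsOpen (K.char t ⁻¹' U)) :
    IsQuotientMap (fun z : Σ t : {t : K.faces // t.1 ∈ F}, {z // K.char t.1 z ∈ U} =>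
      (⟨K.char z.1.1 z.2.1, z.2.2⟩ : U)) := by
  refine ⟨isCoinducing_iff.2 fun O => ⟨fun hO => ?_, fun hO => ?_⟩, fun y => ?_⟩
  · refine isOpen_of_isOpen_char hF hUF fun t ht => ?_
    have := (hU t ht).isOpenMap_subtype_val _ (isOpen_sigma_iff.1 hO ⟨t, ht⟩)
    convert this using 1
    ext z
    constructor
    · rintro ⟨y, hy, e⟩
      refine ⟨⟨z, show K.char t z ∈ U from e ▸ y.2⟩, ?_, rfl⟩
      have : y = ⟨K.char t z, e ▸ y.2⟩ := Subtype.ext e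
      rw [this] at hy
      exact hy
    · rintro ⟨z', hz', rfl⟩
      exact ⟨_, hz', rfl⟩
  · refine hO.preimage (continuous_sigma fun t => Continuous.subtype_mk ?_ _)
    exact (continuous_char t.1).comp continuous_subtype_val
  · obtain ⟨x, -, hx⟩ := K.exists_simplexPoint y.1
    have hx' : K.char ⟨_, y.1.support_mem⟩ (QuotientGroup.mk 1, x) = y.1 := by
      rw [char_mk, one_smul, hx]
    have hm : K.char ⟨_, y.1.support_mem⟩ (QuotientGroup.mk 1, x) ∈ U := by rw [hx']; exact y.2
    exact ⟨⟨⟨⟨_, y.1.support_mem⟩, hUF y.2⟩, ⟨(QuotientGroup.mk 1, x), hm⟩⟩, Subtype.ext hx'⟩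

theorem continuous_of_continuous_char (hF : K.IsSubcomplex F) {U : Set K.Realization}
    (hUF : U ⊆ K.geom F) (hU : ∀ t : K.faces, t.1 ∈ F → IsOpen (K.char t ⁻¹' U))
    {T : Type*} [TopologicalSpace T] {f : U → T}
    (hf : ∀ t : K.faces, t.1 ∈ F →
      Continuous fun z : {z // K.char t z ∈ U} => f ⟨K.char t z.1, z.2⟩) : Continuous f :=
  (isQuotientMap_char_restrict hF hUF hU).continuous_iff.2
    (continuous_sigma fun t => hf t.1 t.2)

/-- The unit interval is locally compact, so the product of a quotient map with it is again a
quotient map; homotopies can thus be checked cell by cell. -/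
theorem continuous_prod_of_continuous_char (hF : K.IsSubcomplex F) {U : Set K.Realization}
    (hUF : U ⊆ K.geom F) (hU : ∀ t : K.faces, t.1 ∈ F → IsOpen (K.char t ⁻¹' U))
    {T : Type*} [TopologicalSpace T] {f : U × I → T}
    (hf : ∀ t : K.faces, t.1 ∈ F →
      Continuous fun z : {z // K.char t z ∈ U} × I => f (⟨K.char t z.1.1, z.1.2⟩, z.2)) :
    Continuous f := by
  apply (isQuotientMap_char_restrict hF hUF hU).continuous_lift_prod_left
  rw [← (Homeomorph.sigmaProdDistrib (Y := I)).symm.comp_continuous_iff', continuous_sigma_iff]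
  exact fun t => hf t.1 t.2

end Topology

end AbstractSimplicialGComplex

/-! ### Radial projection of a simplex from its barycenter -/

section Radial

variable {ι : Type*} [Fintype ι]

/-- The point at time `τ` on the way from `x` to its radial projection from the barycenter of the
simplex to the boundary. -/
noncomputable def radialFun (x : ι → ℝ) (τ : ℝ) (i : ι) : ℝ :=
  (1 - τ) * x i + τ * ((x i - ⨅ j, x j) / (1 - Fintype.card ι * ⨅ j, x j))

/-- Symmetry under relabelling of vertices is what makes the deformation compatible with translation
of simplices. -/
theorem radialFun_comp_equiv {κ : Type*} [Fintype κ] (e : κ ≃ ι) (x : ι → ℝ) (τ : ℝ) (k : κ) :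
    radialFun (x ∘ e) τ k = radialFun x τ (e k) := by
  have h : ⨅ j, x (e j) = ⨅ j, x j := e.iInf_congr fun _ => rfl
  simp only [radialFun, Function.comp_apply, h, Fintype.card_congr e]

theorem radialFun_zero (x : ι → ℝ) : radialFun x 0 = x := by
  ext i; simp [radialFun]

theorem iInf_le_apply (x : ι → ℝ) (i : ι) : ⨅ j, x j ≤ x i :=
  ciInf_le (Set.finite_range x).bddBelow i

/-- The quantity is the sum of the nonnegative numbers `x i - min x`, which vanishes only at the
barycenter. -/
theorem one_sub_card_mul_iInf_pos {x : ι → ℝ} (hx : x ∈ stdSimplex ℝ ι)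
    (hne : ∃ i j, x i ≠ x j) : 0 < 1 - Fintype.card ι * ⨅ j, x j := by
  have hsum : ∑ i, (x i - ⨅ j, x j) = 1 - Fintype.card ι * ⨅ j, x j := by
    rw [Finset.sum_sub_distrib, hx.2, Finset.sum_const, Finset.card_univ, nsmul_eq_mul]
  rw [← hsum]
  refine Finset.sum_pos' (fun i _ => sub_nonneg.2 (iInf_le_apply x i)) ?_
  by_contra! h
  obtain ⟨i, j, hij⟩ := hne
  have h' : ∀ i, x i = ⨅ j, x j := fun i =>
    le_antisymm (sub_nonpos.1 (h i (Finset.mem_univ i))) (iInf_le_apply x i)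
  exact hij ((h' i).trans (h' j).symm)

theorem radialFun_mem {x : ι → ℝ} (hx : x ∈ stdSimplex ℝ ι) (hne : ∃ i j, x i ≠ x j) (τ : I) :
    radialFun x τ ∈ stdSimplex ℝ ι := by
  have hD := one_sub_card_mul_iInf_pos hx hne
  refine ⟨fun i => ?_, ?_⟩
  · have := sub_nonneg.2 (iInf_le_apply x i)
    exact add_nonneg (mul_nonneg (sub_nonneg.2 τ.2.2) (hx.1 i))
      (mul_nonneg τ.2.1 (div_nonneg this hD.le))
  · simp only [radialFun]
    rw [Finset.sum_add_distrib, ← Finset.mul_sum, ← Finset.mul_sum, ← Finset.sum_div,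
      Finset.sum_sub_distrib, hx.2, Finset.sum_const, Finset.card_univ, nsmul_eq_mul,
      div_self hD.ne']
    ring

/-- Coordinate differences are multiplied by a common positive factor, so the path never meets the
barycenter. -/
theorem radialFun_ne {x : ι → ℝ} (hx : x ∈ stdSimplex ℝ ι) {i j : ι} (hij : x i ≠ x j) (τ : I) :
    radialFun x τ i ≠ radialFun x τ j := by
  have hD := one_sub_card_mul_iInf_pos hx ⟨i, j, hij⟩
  intro h
  have h1 : radialFun x τ i - radialFun x τ j =
      ((1 - τ) + τ / (1 - Fintype.card ι * ⨅ j, x j)) * (x i - x j) := by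
    simp only [radialFun]; ring
  rw [h, sub_self] at h1
  have h2 : 0 < (1 - (τ : ℝ)) + τ / (1 - Fintype.card ι * ⨅ j, x j) := by
    rcases eq_or_lt_of_le τ.2.1 with h0 | h0
    · rw [← h0]; norm_num
    · exact add_pos_of_nonneg_of_pos (sub_nonneg.2 τ.2.2) (div_pos h0 hD)
  rcases mul_eq_zero.1 h1.symm with h3 | h3
  · exact h2.ne' h3
  · exact hij (sub_eq_zero.1 h3)

theorem exists_radialFun_one_eq_zero [Nonempty ι] (x : ι → ℝ) : ∃ i, radialFun x 1 i = 0 := by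
  obtain ⟨i, hi⟩ := exists_eq_ciInf_of_finite (f := x)
  exact ⟨i, by simp [radialFun, hi]⟩

/-- On the boundary the minimum is `0`, so boundary points stay fixed and the deformation extends by
the identity over `|F|`. -/
theorem radialFun_of_eq_zero {x : ι → ℝ} (hx : ∀ i, 0 ≤ x i) {i : ι} (hi : x i = 0) (τ : ℝ) :
    radialFun x τ = x := by
  have h : ⨅ j, x j = 0 := by
    have : Nonempty ι := ⟨i⟩
    exact le_antisymm (hi ▸ iInf_le_apply x i) (le_ciInf hx)
  ext j
  simp only [radialFun, h]
  ring

theorem continuous_iInf_apply [Nonempty ι] : Continuous fun x : ι → ℝ => ⨅ i, x i := by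
  simp only [← Finset.inf'_univ_eq_ciInf]
  exact Continuous.finset_inf'_apply Finset.univ_nonempty fun i _ => continuous_apply i

end Radial

/-! ### Deformation of the punctured complex -/

namespace AbstractSimplicialGComplex

section Cells

variable {G V : Type*} [Group G] [MulAction G V] [DecidableEq V]

/-- All barycentric coordinates of `y` in the simplex spanned by its support agree. -/
def IsBarycenter {K : AbstractSimplicialGComplex G V} (y : K.Realization) : Prop :=
  ∀ v ∈ y.coords.support, ∀ w ∈ y.coords.support, y.coords v = y.coords w

/-- The complement in `|F'|` of the barycenters of the simplices that do not belong to `F`. -/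
def punctured (K : AbstractSimplicialGComplex G V) (F F' : Set (Finset V)) :
    Set K.Realization :=
  {y | y ∈ K.geom F' ∧ (y ∈ K.geom F ∨ ¬ IsBarycenter y)}

variable {K : AbstractSimplicialGComplex G V} {F F' : Set (Finset V)}

theorem punctured_subset : K.punctured F F' ⊆ K.geom F' := fun _ h => h.1

theorem geom_subset_punctured (hFF' : F ⊆ F') : K.geom F ⊆ K.punctured F F' :=
  fun _ h => ⟨hFF' h, Or.inl h⟩

theorem IsBarycenter.of_smul {g : G} {y : K.Realization} (h : IsBarycenter (g • y)) :
    IsBarycenter y := by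
  intro v hv w hw
  have := h (g • v) (by rw [support_smul]; exact Finset.smul_mem_smul_finset hv) (g • w)
    (by rw [support_smul]; exact Finset.smul_mem_smul_finset hw)
  rwa [smul_apply, smul_apply, inv_smul_smul, inv_smul_smul] at this

theorem isGInvariant_punctured (hF : K.IsSubcomplex F) (hF' : K.IsSubcomplex F') :
    IsGInvariant G (K.punctured F F') := fun g y hy =>
  ⟨isGInvariant_geom hF' g y hy.1, hy.2.imp (isGInvariant_geom hF g y) fun h h' => h h'.of_smul⟩

/-- `F'` arises from `F` by adding simplices whose boundary belongs to `F`. -/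
def IsCellExtension (F F' : Set (Finset V)) : Prop :=
  F ⊆ F' ∧ ∀ t ∈ F', t ∉ F → ∀ u ⊂ t, u.Nonempty → u ∈ F

theorem simplexPoint_mem_geom_iff (hE : IsCellExtension F F') (t : K.faces) (ht : t.1 ∈ F')
    (htF : t.1 ∉ F) (x : stdSimplex ℝ t.1) :
    K.simplexPoint t x ∈ K.geom F ↔ ∃ v, x.1 v = 0 := by
  constructor
  · intro h
    by_contra! hx
    refine htF ?_
    have : (K.simplexPoint t x).coords.support = t.1 := by
      refine (support_simplexPoint_subset t x).antisymm fun v hv => ?_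
      rw [Finsupp.mem_support_iff, simplexPoint_apply t x ⟨v, hv⟩]
      exact hx _
    rw [← this]
    exact h
  · rintro ⟨v, hv⟩
    refine hE.2 t ht htF _ ((support_simplexPoint_subset t x).ssubset_of_ne fun h => ?_)
      (support_nonempty _)
    have hv' : v.1 ∈ (K.simplexPoint t x).coords.support := by rw [h]; exact v.2
    rw [Finsupp.mem_support_iff, simplexPoint_apply] at hv'
    exact hv' hv

theorem face_nonempty (t : K.faces) : Nonempty t.1 :=
  (K.isRelLowerSet_faces t.2).1.to_subtype

theorem simplexPoint_mem_punctured_iff (hF' : K.IsSubcomplex F') (hE : IsCellExtension F F')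
    (t : K.faces) (ht : t.1 ∈ F') (htF : t.1 ∉ F) (x : stdSimplex ℝ t.1) :
    K.simplexPoint t x ∈ K.punctured F F' ↔ ∃ v w, x.1 v ≠ x.1 w := by
  have hmem : K.simplexPoint t x ∈ K.geom F' :=
    hF'.lower _ ht _ (support_simplexPoint_subset t x) (support_nonempty _)
  constructor
  · rintro ⟨-, h⟩
    by_contra! hx
    rcases h with h | h
    · obtain ⟨v, hv⟩ := (simplexPoint_mem_geom_iff hE t ht htF x).1 h
      have := x.2.2
      rw [Finset.sum_eq_zero fun w _ => (hx w v).trans hv] at this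
      exact zero_ne_one this
    · refine h fun v hv w hw => ?_
      rw [simplexPoint_apply t x ⟨v, support_simplexPoint_subset t x hv⟩,
        simplexPoint_apply t x ⟨w, support_simplexPoint_subset t x hw⟩]
      exact hx _ _
  · rintro ⟨v, w, hvw⟩
    refine ⟨hmem, or_iff_not_imp_left.2 fun h hb => hvw ?_⟩
    have hne : ∀ v, x.1 v ≠ 0 := fun v hv =>
      h ((simplexPoint_mem_geom_iff hE t ht htF x).2 ⟨v, hv⟩)
    rw [← simplexPoint_apply t x v, ← simplexPoint_apply t x w]
    exact hb v (by rw [Finsupp.mem_support_iff, simplexPoint_apply]; exact hne v) w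
      (by rw [Finsupp.mem_support_iff, simplexPoint_apply]; exact hne w)

theorem exists_ne_of_mem_punctured {y : K.Realization} (hy : y ∈ K.punctured F F')
    (hyF : y ∉ K.geom F) :
    ∃ v w, (toSimplex y.coords.support y subset_rfl).1 v ≠
      (toSimplex y.coords.support y subset_rfl).1 w := by
  have := hy.2.resolve_left hyF
  simp only [IsBarycenter, not_forall] at this
  obtain ⟨v, hv, w, hw, h⟩ := this
  exact ⟨⟨v, hv⟩, ⟨w, hw⟩, h⟩

open Classical in
/-- The radial deformation of the punctured space `|F'|` to `|F|`. -/
noncomputable def radialMap (p : K.punctured F F' × I) : K.Realization :=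
  if h : p.1.1 ∈ K.geom F then p.1.1 else
    K.simplexPoint ⟨_, p.1.1.support_mem⟩
      ⟨radialFun (toSimplex p.1.1.coords.support p.1.1 subset_rfl).1 p.2,
        radialFun_mem (Subtype.property _) (exists_ne_of_mem_punctured p.1.2 h) p.2⟩

theorem radialMap_of_mem {p : K.punctured F F' × I} (h : p.1.1 ∈ K.geom F) :
    radialMap p = p.1.1 := dif_pos h

/-- The deformation is defined through the support of each point, without reference to cells. In the
coordinates of any new cell it is the radial formula on the simplex factor, and from this both
continuity and equivariance follow. -/
theorem radialMap_char (hF : K.IsSubcomplex F) (hE : IsCellExtension F F')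
    (t : K.faces) (ht : t.1 ∈ F') (htF : t.1 ∉ F) (c : G ⧸ MulAction.stabilizer G t.1)
    (x : stdSimplex ℝ t.1) (hz : K.char t (c, x) ∈ K.punctured F F')
    (τ : I) (hx : radialFun x.1 τ ∈ stdSimplex ℝ t.1) :
    radialMap (⟨K.char t (c, x), hz⟩, τ) = K.char t (c, ⟨radialFun x.1 τ, hx⟩) := by
  by_cases hm : K.char t (c, x) ∈ K.geom F
  · rw [radialMap_of_mem hm]
    obtain ⟨v, hv⟩ := (simplexPoint_mem_geom_iff hE t ht htF x).1
      ((char_mem_iff (isGInvariant_geom hF) t (c, x)).1 hm)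
    simp only [radialFun_of_eq_zero x.2.1 hv τ]
  · have hne : ∀ v, x.1 v ≠ 0 := fun v hv =>
      hm ((char_mem_iff (isGInvariant_geom hF) t (c, x)).2
        ((simplexPoint_mem_geom_iff hE t ht htF x).2 ⟨v, hv⟩))
    rw [radialMap, dif_neg hm]
    induction c using QuotientGroup.induction_on with
    | H a =>
      have hsupp : (K.char t (QuotientGroup.mk a, x)).coords.support = a • t.1 := by
        rw [char_mk, support_smul]
        congr 1
        refine (support_simplexPoint_subset t x).antisymm fun v hv => ?_
        rw [Finsupp.mem_support_iff, simplexPoint_apply t x ⟨v, hv⟩]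
        exact hne _
      -- Off `|F|` the support of the point is the whole translate `a • t`; the bijection of
      -- vertices given by `a` matches the barycentric coordinates.
      let e : t.1 ≃ (K.char t (QuotientGroup.mk a, x)).coords.support :=
        (MulAction.toPerm a).subtypeEquiv fun v => by
          rw [hsupp]
          exact (Finset.smul_mem_smul_finset_iff a).symm
      have hxe : (toSimplex _ (K.char t (QuotientGroup.mk a, x)) subset_rfl).1 ∘ e = x.1 := by
        ext v
        change (K.char t (QuotientGroup.mk a, x)).coords (a • v.1) = _
        rw [char_mk, smul_apply, inv_smul_smul, simplexPoint_apply]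
      refine Realization.ext (Finsupp.ext fun v => Eq.trans ?_ (smul_apply a _ v).symm)
      by_cases hv : a⁻¹ • v ∈ t.1
      · have hev : (e ⟨a⁻¹ • v, hv⟩).1 = v := smul_inv_smul a v
        rw [simplexPoint_apply t _ ⟨a⁻¹ • v, hv⟩]
        change _ = radialFun x.1 τ _
        conv_lhs => rw [← hev]
        rw [simplexPoint_apply ⟨(K.char t (QuotientGroup.mk a, x)).coords.support, _⟩ _
          (e ⟨a⁻¹ • v, hv⟩)]
        change radialFun _ τ _ = _
        rw [← radialFun_comp_equiv, hxe]
      · rw [Finsupp.notMem_support_iff.1 fun h => hv (support_simplexPoint_subset t _ h),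
          Finsupp.notMem_support_iff.1 fun h => ?_]
        have : v ∈ a • t.1 := by
          rw [← hsupp]
          exact support_simplexPoint_subset _ _ h
        exact hv (Finset.inv_smul_mem_iff.2 this)

end Cells

end AbstractSimplicialGComplex

namespace AbstractSimplicialGComplex

section

variable {G V : Type*} [Group G] [MulAction G V] [DecidableEq V]
  {K : AbstractSimplicialGComplex G V} {F F' : Set (Finset V)}

theorem char_toSimplex_support (y : K.Realization) :
    K.char ⟨_, y.support_mem⟩ (QuotientGroup.mk 1, toSimplex y.coords.support y subset_rfl) = y := by
  rw [char_mk, one_smul, simplexPoint_toSimplex ⟨_, y.support_mem⟩]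

theorem radialMap_smul (hF : K.IsSubcomplex F) (hF' : K.IsSubcomplex F')
    (hE : IsCellExtension F F') (g : G) (y : K.punctured F F') (τ : I) :
    radialMap (⟨g • y.1, isGInvariant_punctured hF hF' g y.1 y.2⟩, τ) = g • radialMap (y, τ) := by
  by_cases hy : y.1 ∈ K.geom F
  · rw [radialMap_of_mem (p := (y, τ)) hy]
    exact radialMap_of_mem (isGInvariant_geom hF g y.1 hy)
  · obtain ⟨y, hyp⟩ := y
    let t : K.faces := ⟨_, y.support_mem⟩
    let x := toSimplex y.coords.support y subset_rfl
    have ht : t.1 ∈ F' := hyp.1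
    have hx := radialFun_mem x.2 (exists_ne_of_mem_punctured hyp hy) τ
    have e : y = K.char t (QuotientGroup.mk 1, x) := (char_toSimplex_support y).symm
    have eg : g • y = K.char t (QuotientGroup.mk g, x) := by
      conv_lhs => rw [e]
      rw [smul_char]
      change K.char t (QuotientGroup.mk (g * 1), x) = _
      rw [mul_one]
    have h1 : radialMap (⟨y, hyp⟩, τ) = K.char t (QuotientGroup.mk 1, ⟨radialFun x.1 τ, hx⟩) := by
      rw [← radialMap_char hF hE t ht hy _ x (e ▸ hyp) τ hx]
      congr 3
    have h2 : radialMap (⟨g • y, isGInvariant_punctured hF hF' g y hyp⟩, τ) =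
        K.char t (QuotientGroup.mk g, ⟨radialFun x.1 τ, hx⟩) := by
      rw [← radialMap_char hF hE t ht hy _ x (eg ▸ isGInvariant_punctured hF hF' g y hyp) τ hx]
      congr 3
    rw [h1, h2, smul_char]
    change _ = K.char t (QuotientGroup.mk (g * 1), _)
    rw [mul_one]

theorem radialMap_mem (hF' : K.IsSubcomplex F') (hE : IsCellExtension F F')
    (p : K.punctured F F' × I) : radialMap p ∈ K.punctured F F' := by
  by_cases hy : p.1.1 ∈ K.geom F
  · rw [radialMap_of_mem hy]
    exact p.1.2
  · rw [radialMap, dif_neg hy]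
    refine (simplexPoint_mem_punctured_iff hF' hE ⟨_, p.1.1.support_mem⟩ p.1.2.1 hy _).2 ?_
    obtain ⟨v, w, h⟩ := exists_ne_of_mem_punctured p.1.2 hy
    exact ⟨v, w, radialFun_ne (Subtype.property _) h p.2⟩

theorem radialMap_zero (y : K.punctured F F') : radialMap (y, 0) = y.1 := by
  by_cases hy : y.1 ∈ K.geom F
  · exact radialMap_of_mem hy
  · rw [radialMap, dif_neg hy]
    convert simplexPoint_toSimplex ⟨_, y.1.support_mem⟩ y.1 subset_rfl
    exact radialFun_zero _

theorem radialMap_one_mem (hE : IsCellExtension F F') (y : K.punctured F F') :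
    radialMap (y, 1) ∈ K.geom F := by
  by_cases hy : y.1 ∈ K.geom F
  · rwa [radialMap_of_mem (p := (y, 1)) hy]
  · rw [radialMap, dif_neg hy]
    refine (simplexPoint_mem_geom_iff hE ⟨_, y.1.support_mem⟩ y.2.1 hy _).2 ?_
    have : Nonempty y.1.coords.support := (support_nonempty y.1).to_subtype
    exact exists_radialFun_one_eq_zero _

variable [TopologicalSpace G]

/-- Cells of `F` lie entirely in the punctured space. In a new cell the preimage consists of the
points with two distinct coordinates, an open condition. -/
theorem isOpen_char_preimage_punctured (hF : K.IsSubcomplex F) (hF' : K.IsSubcomplex F')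
    (hE : IsCellExtension F F') (t : K.faces) (ht : t.1 ∈ F') :
    IsOpen (K.char t ⁻¹' K.punctured F F') := by
  by_cases htF : t.1 ∈ F
  · convert isOpen_univ
    exact Set.eq_univ_of_forall fun z => geom_subset_punctured hE.1 (char_mem_geom hF t htF z)
  · have : K.char t ⁻¹' K.punctured F F' =
        ⋃ v : t.1, ⋃ w : t.1, {z | z.2.1 v ≠ z.2.1 w} := by
      ext z
      rw [Set.mem_preimage, char_mem_iff (isGInvariant_punctured hF hF'),
        simplexPoint_mem_punctured_iff hF' hE t ht htF]
      simp only [Set.mem_iUnion]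
      rfl
    rw [this]
    have hc : ∀ v, Continuous fun z : (G ⧸ MulAction.stabilizer G t.1) × stdSimplex ℝ t.1 =>
        z.2.1 v := fun v => (continuous_apply v).comp (continuous_subtype_val.comp continuous_snd)
    exact isOpen_iUnion fun v => isOpen_iUnion fun w => isOpen_ne_fun (hc v) (hc w)

theorem continuous_radialMap (hF : K.IsSubcomplex F) (hF' : K.IsSubcomplex F')
    (hE : IsCellExtension F F') : Continuous (radialMap (K := K) (F := F) (F' := F')) := by
  refine continuous_prod_of_continuous_char hF' punctured_subset
    (isOpen_char_preimage_punctured hF hF' hE) fun t ht => ?_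
  by_cases htF : t.1 ∈ F
  · have : (fun z : {z // K.char t z ∈ K.punctured F F'} × I =>
        radialMap (⟨K.char t z.1.1, z.1.2⟩, z.2)) = fun z => K.char t z.1.1 := by
      ext1 z
      exact radialMap_of_mem (char_mem_geom hF t htF z.1.1)
    rw [this]
    exact (continuous_char t).comp (continuous_subtype_val.comp continuous_fst)
  · have hne : ∀ z : {z // K.char t z ∈ K.punctured F F'}, ∃ v w, z.1.2.1 v ≠ z.1.2.1 w := fun z =>
      (simplexPoint_mem_punctured_iff hF' hE t ht htF _).1
        ((char_mem_iff (isGInvariant_punctured hF hF') t z.1).1 z.2)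
    have : (fun z : {z // K.char t z ∈ K.punctured F F'} × I =>
        radialMap (⟨K.char t z.1.1, z.1.2⟩, z.2)) = fun z => K.char t (z.1.1.1,
          ⟨radialFun z.1.1.2.1 z.2, radialFun_mem z.1.1.2.2 (hne z.1) z.2⟩) := by
      ext1 z
      exact radialMap_char hF hE t ht htF z.1.1.1 z.1.1.2 z.1.2 z.2 _
    rw [this]
    refine (continuous_char t).comp (Continuous.prodMk (by fun_prop)
      (Continuous.subtype_mk (continuous_pi fun v => ?_) _))
    have := face_nonempty t
    have hinf : Continuous fun z : {z // K.char t z ∈ K.punctured F F'} × I =>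
        ⨅ v, z.1.1.2.1 v := continuous_iInf_apply.comp (by fun_prop)
    simp only [radialFun]
    have hc : Continuous fun z : {z // K.char t z ∈ K.punctured F F'} × I => z.1.1.2.1 v :=
      (continuous_apply v).comp (by fun_prop)
    have hτ : Continuous fun z : {z // K.char t z ∈ K.punctured F F'} × I => (z.2 : ℝ) :=
      by fun_prop
    exact ((continuous_const.sub hτ).mul hc).add <| hτ.mul <|
      (hc.sub hinf).div (continuous_const.sub (continuous_const.mul hinf))
        fun z => (one_sub_card_mul_iInf_pos z.1.1.2.2 (hne z.1)).ne'

theorem isOpen_punctured (hF : K.IsSubcomplex F) (hF' : K.IsSubcomplex F')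
    (hE : IsCellExtension F F') :
    IsOpen {y : K.geom F' | y.1 ∈ K.punctured F F'} := by
  refine isOpen_of_isOpen_char hF' subset_rfl fun t ht => ?_
  convert isOpen_char_preimage_punctured hF hF' hE t ht
  ext y
  exact ⟨fun ⟨z, hz, e⟩ => e ▸ hz, fun h => ⟨⟨y, h.1⟩, h, rfl⟩⟩

end

end AbstractSimplicialGComplex

/-! ### Excision to the open cells -/

namespace EquivariantHomologyTheory

open GPair AbstractSimplicialGComplex

variable {G V : Type u} [Group G] [TopologicalSpace G] [ContinuousMul G] [LocallyCompactSpace G]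
  [MulAction G V] [DecidableEq V] {R : Type v} [Ring R]
  {h : EquivariantHomologyTheory.{u, v, w} G R}
  {K : AbstractSimplicialGComplex G V} {F F' : Set (Finset V)}

theorem vanishes_punctured (n : ℤ) (hF : K.IsSubcomplex F) (hF' : K.IsSubcomplex F')
    (hE : IsCellExtension F F') :
    h.Vanishes n ((space G K.Realization).subpair (K.punctured F F') (K.geom F)
      (isGInvariant_punctured hF hF') (isGInvariant_geom hF)) := by
  refine vanishes_of_compression n (fun p => ⟨radialMap p, radialMap_mem hF' hE p⟩)
    ((continuous_radialMap hF hF' hE).subtype_mk _) ?_ ?_ ?_ ?_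
  · exact fun g x t => Subtype.ext (radialMap_smul hF hF' hE g x t)
  · intro x hx t
    change radialMap (x, t) ∈ K.geom F
    rw [radialMap_of_mem (p := (x, t)) hx]
    exact hx
  · exact fun x => Subtype.ext (radialMap_zero x)
  · exact fun x => radialMap_one_mem hE x

/-- Vanishing of the homology of `(|F'|, |F|)` can be checked on the open cells. -/
theorem vanishes_geom_of_openCells {n : ℤ} (hF : K.IsSubcomplex F) (hF' : K.IsSubcomplex F')
    (hE : IsCellExtension F F')
    (hv : h.Vanishes n ((space G K.Realization).subpair (K.geom F' \ K.geom F)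
      (K.punctured F F' \ K.geom F)
      (isGInvariant_diff (P := space G K.Realization) (isGInvariant_geom hF')
        (isGInvariant_geom hF))
      (isGInvariant_diff (P := space G K.Realization) (isGInvariant_punctured hF hF')
        (isGInvariant_geom hF)))) :
    h.Vanishes n ((space G K.Realization).subpair (K.geom F') (K.geom F)
      (isGInvariant_geom hF') (isGInvariant_geom hF)) := by
  -- In the triple formed by `|F|`, the punctured space and `|F'|`, the lower pair vanishes by
  -- radial deformation. For the upper pair, `|F|` is closed inside the open punctured space and is
  -- excised.
  refine Vanishes.trans (geom_subset_punctured hE.1) punctured_subset ?_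
    (vanishes_punctured n hF hF' hE)
  let Q := (space G K.Realization).subpair (K.geom F') (K.punctured F F')
    (isGInvariant_geom hF') (isGInvariant_punctured hF hF')
  let U : Set Q.carrier := {y | y.1 ∈ K.geom F}
  have hU : IsGInvariant G U := fun g y hy => isGInvariant_geom hF g y.1 hy
  refine Vanishes.of_excision (P := Q) hU ?_ ?_
  · have h1 : IsClosed U := (isClosed_geom hF).preimage continuous_subtype_val
    have h2 : IsOpen Q.sub := isOpen_punctured hF hF' hE
    rw [h1.closure_eq, h2.interior_eq]
    exact fun y hy => geom_subset_punctured hE.1 hy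
  · exact hv.of_retract
      { toFun := fun y => ⟨y.1.1, y.1.2, y.2⟩
        continuous_toFun := ((continuous_subpair_val _ _ _ _ _).comp
          (continuous_subpair_val Q _ _ (isGInvariant_compl hU)
            (isGInvariant_diff Q.sub_inv hU))).subtype_mk _
        map_smul := fun _ _ => rfl
        map_sub := fun _ hx => hx }
      { toFun := fun y => ⟨⟨y.1, y.2.1⟩, y.2.2⟩
        continuous_toFun := (continuous_subtype_val.subtype_mk _).subtype_mk _
        map_smul := fun _ _ => rfl
        map_sub := fun _ hx => hx } fun _ => rfl

end EquivariantHomologyTheory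

/-! ### Euclidean coordinates on an open equivariant cell -/

namespace AbstractSimplicialGComplex

section Softmax

variable {V : Type*} {s : Finset V} {p : ℕ}

/-- The homeomorphism from Euclidean space to the interior of a simplex. -/
noncomputable def softmax (e : Fin (p + 1) ≃ s) (u : Fin p → ℝ) : stdSimplex ℝ s :=
  ⟨fun v => Real.exp ((Fin.cons 0 u : Fin (p + 1) → ℝ) (e.symm v)) /
    ∑ j, Real.exp ((Fin.cons 0 u : Fin (p + 1) → ℝ) j),
    fun v => by positivity, by
      have h : 0 < ∑ j, Real.exp ((Fin.cons 0 u : Fin (p + 1) → ℝ) j) := by positivity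
      rw [← Finset.sum_div, e.symm.sum_comp fun j => Real.exp ((Fin.cons 0 u : _ → ℝ) j),
        div_self h.ne']⟩

theorem softmax_apply (e : Fin (p + 1) ≃ s) (u : Fin p → ℝ) (j : Fin (p + 1)) :
    (softmax e u).1 (e j) = Real.exp ((Fin.cons 0 u : Fin (p + 1) → ℝ) j) /
      ∑ j, Real.exp ((Fin.cons 0 u : Fin (p + 1) → ℝ) j) := by
  change Real.exp ((Fin.cons 0 u : Fin (p + 1) → ℝ) (e.symm (e j))) / _ = _
  rw [e.symm_apply_apply]

theorem softmax_pos (e : Fin (p + 1) ≃ s) (u : Fin p → ℝ) (v : s) : 0 < (softmax e u).1 v := by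
  change 0 < _ / _
  positivity

theorem continuous_softmax (e : Fin (p + 1) ≃ s) : Continuous (softmax e) := by
  have h : ∀ j, Continuous fun u : Fin p → ℝ => (Fin.cons 0 u : Fin (p + 1) → ℝ) j := fun j =>
    Fin.cases (by simpa only [Fin.cons_zero] using continuous_const)
      (fun j => by simpa only [Fin.cons_succ] using continuous_apply j) j
  refine Continuous.subtype_mk (continuous_pi fun v => ?_) _
  refine Continuous.div (Real.continuous_exp.comp (h _))
    (continuous_finsetSum _ fun j _ => Real.continuous_exp.comp (h j)) fun u => ?_
  have h : 0 < ∑ j, Real.exp ((Fin.cons 0 u : Fin (p + 1) → ℝ) j) := by positivity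
  exact h.ne'

/-- The exponentials of the logarithmic coordinates are the ratios `x j / x 0`, whose sum is `1 / x
0` because the coordinates of `x` add up to `1`. -/
theorem softmax_log (e : Fin (p + 1) ≃ s) {x : stdSimplex ℝ s} (hx : ∀ v, 0 < x.1 v) :
    softmax e (fun i => Real.log (x.1 (e i.succ)) - Real.log (x.1 (e 0))) = x := by
  have h : ∀ j, Real.exp ((Fin.cons 0 (fun i => Real.log (x.1 (e i.succ)) -
      Real.log (x.1 (e 0))) : Fin (p + 1) → ℝ) j) = x.1 (e j) / x.1 (e 0) := by
    refine fun j => Fin.cases ?_ (fun i => ?_) j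
    · rw [Fin.cons_zero, Real.exp_zero, div_self (hx _).ne']
    · rw [Fin.cons_succ, Real.exp_sub, Real.exp_log (hx _), Real.exp_log (hx _)]
  refine Subtype.ext (funext fun v => ?_)
  obtain ⟨j, rfl⟩ := e.surjective v
  rw [softmax_apply]
  simp only [h]
  have h2 : ∑ j, x.1 (e j) = 1 := (e.sum_comp x.1).trans x.2.2
  rw [← Finset.sum_div, h2]
  have := (hx (e 0)).ne'
  field_simp

/-- The origin corresponds to the barycenter, so puncturing the cell removes exactly `0` from
Euclidean space. -/
theorem softmax_ne_iff {e : Fin (p + 1) ≃ s} {u : Fin p → ℝ} :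
    (∃ v w, (softmax e u).1 v ≠ (softmax e u).1 w) ↔ u ≠ 0 := by
  constructor
  · rintro ⟨v, w, h⟩ rfl
    obtain ⟨i, rfl⟩ := e.surjective v
    obtain ⟨j, rfl⟩ := e.surjective w
    have h0 : ∀ j, (Fin.cons 0 0 : Fin (p + 1) → ℝ) j = 0 := fun j =>
      Fin.cases rfl (fun _ => rfl) j
    rw [softmax_apply, softmax_apply, h0, h0] at h
    exact h rfl
  · intro hu
    obtain ⟨i, hi⟩ := Function.ne_iff.1 hu
    refine ⟨e i.succ, e 0, fun h => hi ?_⟩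
    have h' : 0 < ∑ j, Real.exp ((Fin.cons 0 u : Fin (p + 1) → ℝ) j) := by positivity
    rw [softmax_apply, softmax_apply, div_left_inj' h'.ne', Real.exp_eq_exp, Fin.cons_succ,
      Fin.cons_zero] at h
    exact h

end Softmax

section Orbit

variable {G V : Type*} [Group G] [MulAction G V] [DecidableEq V]
  {K : AbstractSimplicialGComplex G V} {F : Set (Finset V)}

/-- The set `F` together with the orbit of `s`. -/
def addOrbit (G : Type*) {V : Type*} [Group G] [MulAction G V] [DecidableEq V]
    (F : Set (Finset V)) (s : Finset V) : Set (Finset V) :=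
  F ∪ Set.range fun g : G => g • s

theorem lower_of_mem_orbit (hF : K.IsSubcomplex F) {s : Finset V}
    (hs : ∀ u ⊂ s, u.Nonempty → u ∈ F) (g : G) {u : Finset V} (hu : u ⊂ g • s)
    (hne : u.Nonempty) : u ∈ F := by
  rw [← hF.smul_mem_iff g⁻¹]
  refine hs _ ?_ hne.smul_finset
  rw [Finset.ssubset_iff_subset_ne] at hu ⊢
  refine ⟨Finset.smul_finset_subset_iff.2 (by simpa using hu.1), fun h => hu.2 ?_⟩
  rw [← h, smul_inv_smul]

theorem isSubcomplex_addOrbit (hF : K.IsSubcomplex F) {s : Finset V} (hsK : s ∈ K.faces)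
    (hs : ∀ u ⊂ s, u.Nonempty → u ∈ F) : K.IsSubcomplex (addOrbit G F s) where
  subset := Set.union_subset hF.subset fun t ⟨g, hg⟩ => hg ▸ K.smul_mem g s hsK
  lower := by
    rintro t (ht | ⟨g, rfl⟩) u hu hne
    · exact Or.inl (hF.lower t ht u hu hne)
    · rcases eq_or_ssubset_of_subset hu with h | h
      · exact Or.inr ⟨g, h.symm⟩
      · exact Or.inl (lower_of_mem_orbit hF hs g h hne)
  smul := by
    rintro g t (ht | ⟨k, rfl⟩)
    · exact Or.inl (hF.smul g t ht)
    · exact Or.inr ⟨g * k, mul_smul g k s⟩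

theorem isCellExtension_addOrbit (hF : K.IsSubcomplex F) {s : Finset V}
    (hs : ∀ u ⊂ s, u.Nonempty → u ∈ F) : IsCellExtension F (addOrbit G F s) := by
  refine ⟨Set.subset_union_left, ?_⟩
  rintro t (ht | ⟨g, rfl⟩) htF u hu hne
  · exact (htF ht).elim
  · exact lower_of_mem_orbit hF hs g hu hne

variable {s : K.faces} {p : ℕ}

/-- The coordinates in `G/G_s × ℝᵖ` of a point in the open simplex `g s`. -/
noncomputable def cellCoord (e : Fin (p + 1) ≃ s.1) (g : G) (y : K.Realization) :
    (G ⧸ MulAction.stabilizer G s.1) × (Fin p → ℝ) :=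
  (QuotientGroup.mk g, fun i => Real.log (y.coords (g • (e i.succ).1)) -
    Real.log (y.coords (g • (e 0).1)))

/-- Two elements carrying `s` to the same simplex differ by a stabilizer element, which fixes every
vertex of `s`. So the choice of `g` in `orbitCoord` does not matter. -/
theorem cellCoord_congr (e : Fin (p + 1) ≃ s.1) {g k : G} (hgk : g • s.1 = k • s.1)
    (y : K.Realization) : cellCoord e g y = cellCoord e k y := by
  have hst : g⁻¹ * k ∈ MulAction.stabilizer G s.1 := by
    rw [MulAction.mem_stabilizer_iff, mul_smul, ← hgk, inv_smul_smul]
  have hfix : ∀ v : s.1, g • v.1 = k • v.1 := fun v => by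
    have := K.fixed s.1 s.2 _ hst v.1 v.2
    rw [mul_smul, inv_smul_eq_iff] at this
    exact this.symm
  refine Prod.ext (QuotientGroup.eq.2 hst) ?_
  simp only [cellCoord, hfix]

theorem char_softmax_cellCoord (e : Fin (p + 1) ≃ s.1) {g : G} {y : K.Realization}
    (hy : y.coords.support = g • s.1) :
    K.char s ((cellCoord e g y).1, softmax e (cellCoord e g y).2) = y := by
  have hsup : (g⁻¹ • y).coords.support = s.1 := by rw [support_smul, hy, inv_smul_smul]
  have hval : ∀ v : s.1, (toSimplex s.1 (g⁻¹ • y) hsup.subset).1 v = y.coords (g • v.1) := by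
    intro v
    change (g⁻¹ • y).coords v.1 = _
    rw [smul_apply, inv_inv]
  have hpos : ∀ v, 0 < (toSimplex s.1 (g⁻¹ • y) hsup.subset).1 v := by
    intro v
    rw [hval]
    refine lt_of_le_of_ne (y.nonneg _) (Ne.symm ?_)
    rw [← Finsupp.mem_support_iff, hy]
    exact Finset.smul_mem_smul_finset v.2
  have := softmax_log e hpos
  simp only [hval] at this
  change K.char s (QuotientGroup.mk g, softmax e fun i =>
    Real.log (y.coords (g • (e i.succ).1)) - Real.log (y.coords (g • (e 0).1))) = y
  rw [this, char_mk, simplexPoint_toSimplex, smul_inv_smul]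

theorem cellCoord_smul (e : Fin (p + 1) ≃ s.1) (g k : G) (y : K.Realization) :
    cellCoord e (k * g) (k • y) = (k • (cellCoord e g y).1, (cellCoord e g y).2) := by
  refine Prod.ext rfl (funext fun i => ?_)
  simp only [cellCoord, smul_apply, mul_smul, inv_smul_smul]

theorem exists_support_eq_smul {y : K.Realization}
    (hy : y ∈ K.geom (addOrbit G F s.1) \ K.geom F) : ∃ g : G, y.coords.support = g • s.1 := by
  obtain ⟨g, hg⟩ := hy.1.resolve_left hy.2
  exact ⟨g, hg.symm⟩

/-- The coordinates in `G/G_s × ℝᵖ` of a point in the open equivariant cell of `s`. -/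
noncomputable def orbitCoord (e : Fin (p + 1) ≃ s.1)
    (y : (K.geom (addOrbit G F s.1) \ K.geom F : Set K.Realization)) :
    (G ⧸ MulAction.stabilizer G s.1) × (Fin p → ℝ) :=
  cellCoord e (exists_support_eq_smul y.2).choose y.1

theorem orbitCoord_eq (e : Fin (p + 1) ≃ s.1)
    (y : (K.geom (addOrbit G F s.1) \ K.geom F : Set K.Realization)) {g : G}
    (hg : y.1.coords.support = g • s.1) : orbitCoord e y = cellCoord e g y.1 :=
  cellCoord_congr e ((exists_support_eq_smul y.2).choose_spec.symm.trans hg) y.1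

theorem notMem_of_simplexPoint_notMem (hF : K.IsSubcomplex F) (t : K.faces) {x : stdSimplex ℝ t.1}
    (hx : K.simplexPoint t x ∉ K.geom F) : t.1 ∉ F := fun h =>
  hx (hF.lower _ h _ (support_simplexPoint_subset t x) (support_nonempty _))

theorem support_simplexPoint_of_notMem {F' : Set (Finset V)} (hF : K.IsSubcomplex F)
    (hE : IsCellExtension F F') (t : K.faces) (ht : t.1 ∈ F') {x : stdSimplex ℝ t.1}
    (hx : K.simplexPoint t x ∉ K.geom F) : (K.simplexPoint t x).coords.support = t.1 := by
  by_contra h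
  exact hx (hE.2 t ht (notMem_of_simplexPoint_notMem hF t hx) _
    ((support_simplexPoint_subset t x).ssubset_of_ne h) (support_nonempty _))

theorem orbitCoord_smul (e : Fin (p + 1) ≃ s.1) (g : G)
    (y : (K.geom (addOrbit G F s.1) \ K.geom F : Set K.Realization))
    (hgy : g • y.1 ∈ K.geom (addOrbit G F s.1) \ K.geom F) :
    orbitCoord e ⟨g • y.1, hgy⟩ = (g • (orbitCoord e y).1, (orbitCoord e y).2) := by
  obtain ⟨k, hk⟩ := exists_support_eq_smul y.2
  rw [orbitCoord_eq e y hk, ← cellCoord_smul]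
  exact orbitCoord_eq e _ (by rw [support_smul, hk, mul_smul])

variable [TopologicalSpace G] [ContinuousMul G]

/-- Checked in the cell of each translate `t = k • s`, where the coordinates are a map of coset
spaces and differences of logarithms of positive functions. -/
theorem continuous_orbitCoord (hF : K.IsSubcomplex F) (hs : ∀ u ⊂ s.1, u.Nonempty → u ∈ F)
    (e : Fin (p + 1) ≃ s.1) : Continuous (orbitCoord (K := K) (F := F) e) := by
  have hF' := isSubcomplex_addOrbit hF s.2 hs
  have hE := isCellExtension_addOrbit hF hs
  refine continuous_of_continuous_char hF' Set.sdiff_subset (fun t ht => ?_) fun t ht => ?_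
  · convert (isClosed_geom hF).isOpen_compl.preimage (continuous_char t) using 1
    ext z
    exact ⟨fun h => h.2, fun h => ⟨char_mem_geom hF' t ht z, h⟩⟩
  · rcases ht with htF | ⟨k, hk⟩
    -- For `t` in `F` the domain is empty.
    · refine continuous_iff_continuousAt.2 fun z => ?_
      exact (z.2.2 (char_mem_geom hF t htF z.1)).elim
    · have hst : ∀ a b : G, a⁻¹ * b ∈ MulAction.stabilizer G t.1 →
          (a * k)⁻¹ * (b * k) ∈ MulAction.stabilizer G s.1 := by
        intro a b hab
        rw [MulAction.mem_stabilizer_iff, ← hk] at hab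
        rw [MulAction.mem_stabilizer_iff, mul_inv_rev, mul_assoc, ← mul_assoc a⁻¹, mul_smul,
          mul_smul, hab]
        exact inv_smul_smul k s.1
      -- The stabilizer of `t = k • s` is the conjugate of that of `s` by `k`, so right
      -- multiplication by `k` passes to cosets.
      let r : G ⧸ MulAction.stabilizer G t.1 → G ⧸ MulAction.stabilizer G s.1 :=
        Quotient.map' (· * k) fun a b hab => QuotientGroup.leftRel_apply.2
          (hst a b (QuotientGroup.leftRel_apply.1 hab))
      have hr : Continuous r := isQuotientMap_quotient_mk'.continuous_iff.2
        (QuotientGroup.continuous_mk.comp (continuous_mul_const k))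
      have hmem : ∀ v : s.1, k • v.1 ∈ t.1 := fun v => by
        rw [← hk]; exact Finset.smul_mem_smul_finset v.2
      have hnm : ∀ z : {z // K.char t z ∈ K.geom (addOrbit G F s.1) \ K.geom F},
          K.simplexPoint t z.1.2 ∉ K.geom F := fun z h =>
        z.2.2 ((char_mem_iff (isGInvariant_geom hF) t z.1).2 h)
      have key : (fun z : {z // K.char t z ∈ K.geom (addOrbit G F s.1) \ K.geom F} =>
          orbitCoord e ⟨K.char t z.1, z.2⟩) = fun z => (r z.1.1, fun i =>
            Real.log (z.1.2.1 ⟨_, hmem (e i.succ)⟩) - Real.log (z.1.2.1 ⟨_, hmem (e 0)⟩)) := by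
        ext1 ⟨⟨c, x⟩, hz⟩
        have hsup := support_simplexPoint_of_notMem hF hE t (Or.inr ⟨k, hk⟩) (hnm ⟨(c, x), hz⟩)
        induction c using QuotientGroup.induction_on with
        | H a =>
          have h1 : (K.char t (QuotientGroup.mk a, x)).coords.support = (a * k) • s.1 := by
            rw [char_mk, support_smul, hsup, ← hk, mul_smul]
          rw [orbitCoord_eq e _ h1]
          refine (cellCoord_smul e k a (K.simplexPoint t x)).trans (Prod.ext rfl ?_)
          ext i
          change Real.log _ - Real.log _ = _
          rw [simplexPoint_apply t x ⟨_, hmem (e i.succ)⟩, simplexPoint_apply t x ⟨_, hmem (e 0)⟩]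
      rw [key]
      have hlog : ∀ v : t.1, Continuous fun z :
          {z // K.char t z ∈ K.geom (addOrbit G F s.1) \ K.geom F} => Real.log (z.1.2.1 v) := by
        refine fun v => Continuous.log ((continuous_apply v).comp (by fun_prop)) fun z => ?_
        rw [← simplexPoint_apply, ← Finsupp.mem_support_iff,
          support_simplexPoint_of_notMem hF hE t (Or.inr ⟨k, hk⟩) (hnm z)]
        exact v.2
      exact (hr.comp (by fun_prop)).prodMk (continuous_pi fun i => (hlog _).sub (hlog _))

end Orbit

end AbstractSimplicialGComplex

/-! ### Attaching one equivariant cell -/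

namespace EquivariantHomologyTheory

open GPair AbstractSimplicialGComplex

variable {G V : Type u} [Group G] [TopologicalSpace G] [IsTopologicalGroup G]
  [LocallyCompactSpace G] [MulAction G V] [DecidableEq V] {R : Type v} [Ring R]
  {h : EquivariantHomologyTheory.{u, v, w} G R}
  {K : AbstractSimplicialGComplex G V} {F : Set (Finset V)}

/-- Attaching an equivariant cell of dimension `p` does not change homology in degree `n` if the
homology of its orbit vanishes in degree `n - p`. -/
theorem vanishes_addOrbit {n : ℤ} {p : ℕ} (hF : K.IsSubcomplex F) (s : K.faces) (hsF : s.1 ∉ F)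
    (hs : ∀ u ⊂ s.1, u.Nonempty → u ∈ F) (hp : s.1.card = p + 1)
    (hv : h.Vanishes (n - p) (space G (G ⧸ MulAction.stabilizer G s.1))) :
    h.Vanishes n ((space G K.Realization).subpair (K.geom (addOrbit G F s.1)) (K.geom F)
      (isGInvariant_geom (isSubcomplex_addOrbit hF s.2 hs)) (isGInvariant_geom hF)) := by
  have hF' := isSubcomplex_addOrbit hF s.2 hs
  have hE := isCellExtension_addOrbit (G := G) hF hs
  have hsF' : s.1 ∈ addOrbit G F s.1 := Or.inr ⟨1, one_smul _ _⟩
  let e : Fin (p + 1) ≃ s.1 := (s.1.equivFinOfCardEq hp).symm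
  refine vanishes_geom_of_openCells hF hF' hE ?_
  have hnm : ∀ c u, K.char s (c, softmax e u) ∉ K.geom F := fun c u hm => by
    obtain ⟨v, hv⟩ := (simplexPoint_mem_geom_iff hE s hsF' hsF _).1
      ((char_mem_iff (isGInvariant_geom hF) s (c, softmax e u)).1 hm)
    exact (softmax_pos e u v).ne' hv
  have hpu : ∀ c u, K.char s (c, softmax e u) ∈ K.punctured F (addOrbit G F s.1) ↔ u ≠ 0 :=
    fun c u => (char_mem_iff (isGInvariant_punctured hF hF') s (c, softmax e u)).trans
      ((simplexPoint_mem_punctured_iff hF' hE s hsF' hsF _).trans softmax_ne_iff)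
  have hinv : ∀ y, K.char s ((orbitCoord (K := K) (F := F) e y).1, softmax e (orbitCoord e y).2) =
      y.1 := fun y => by
    obtain ⟨g, hg⟩ := exists_support_eq_smul y.2
    rw [orbitCoord_eq e y hg, char_softmax_cellCoord e hg]
  -- The open cell embeds into `G/G_s × (ℝ^p, ℝ^p ∖ 0)` by its coordinates, with the characteristic
  -- map after `softmax` as a left inverse.
  exact (Vanishes.prodEuclidean p hv).of_retract
    { toFun := fun y => orbitCoord e y
      continuous_toFun := continuous_orbitCoord hF hs e
      map_smul := fun g y => orbitCoord_smul e g y _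
      map_sub := fun y hy => (hpu _ _).1 ((hinv y).symm ▸ hy.1) }
    { toFun := fun z => ⟨K.char s (z.1, softmax e z.2), char_mem_geom hF' s hsF' _, hnm _ _⟩
      continuous_toFun := Continuous.subtype_mk ((continuous_char s).comp
        (continuous_fst.prodMk ((continuous_softmax e).comp continuous_snd))) _
      map_smul := fun g z => Subtype.ext (K.smul_char s g (z.1, softmax e z.2)).symm
      map_sub := fun z hz => ⟨(hpu z.1 z.2).2 hz, hnm _ _⟩ } fun y => Subtype.ext (hinv y)

end EquivariantHomologyTheory

/-! ### Compact sets meet finitely many equivariant cells -/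

namespace AbstractSimplicialGComplex

section Compact

variable {G V : Type*} [Group G] [MulAction G V] [DecidableEq V]
  {K : AbstractSimplicialGComplex G V}

/-- An element stabilizing the support of `y` fixes its vertices and hence `y`. So an orbit has at
most one point in each open simplex. -/
theorem smul_eq_of_support {g k : G} {y : K.Realization}
    (h : (g • y).coords.support = (k • y).coords.support) : g • y = k • y := by
  rw [support_smul, support_smul] at h
  have hst : (k⁻¹ * g) ∈ MulAction.stabilizer G y.coords.support := by
    rw [MulAction.mem_stabilizer_iff, mul_smul, h, inv_smul_smul]
  have := K.smul_simplexPoint_of_mem ⟨_, y.support_mem⟩ (toSimplex _ y subset_rfl) _ hst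
  rw [simplexPoint_toSimplex ⟨_, y.support_mem⟩, mul_smul, inv_smul_eq_iff] at this
  exact this

/-- A union of orbits, at most one in each equivariant open cell, is closed. -/
theorem isClosed_of_injOn_support [TopologicalSpace G] {D : Set K.Realization}
    (hD : IsGInvariant G D) (hinj : Set.InjOn (fun y => y.coords.support) D) : IsClosed D := by
  refine (isClosed_iff_char D).2 fun t => ?_
  -- A simplex has finitely many faces and `D` has at most one point with a given support. The
  -- preimage of `D` in the cell is then `G/G_t` times a finite set.
  have hfin : {x | K.simplexPoint t x ∈ D}.Finite := by
    refine Set.Finite.of_finite_image (f := fun x => (K.simplexPoint t x).coords.support)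
      (t.1.powerset.finite_toSet.subset ?_) ?_
    · rintro _ ⟨x, -, rfl⟩
      exact Finset.mem_coe.2 (Finset.mem_powerset.2 (support_simplexPoint_subset t x))
    · exact fun x hx y hy hxy => simplexPoint_injective t (hinj hx hy hxy)
  convert hfin.isClosed.preimage continuous_snd using 1
  ext z
  exact char_mem_iff hD t z

/-- A compact subset of the realization meets only finitely many equivariant open cells. -/
theorem exists_finset_of_isCompact [TopologicalSpace G] {Y : Set K.Realization}
    (hY : IsCompact Y) :
    ∃ T : Finset (Finset V), ∀ y ∈ Y, ∃ s ∈ T, ∃ g : G, y.coords.support = g • s := by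
  let ω : K.Realization → MulAction.orbitRel.Quotient G (Finset V) := fun y =>
    Quotient.mk _ y.coords.support
  have hω : ∀ (g : G) (y : K.Realization), ω (g • y) = ω y := fun g y =>
    Quotient.sound (by
      rw [support_smul]
      exact ⟨g, rfl⟩)
  have hrep : ∀ q : ω '' Y, ∃ y ∈ Y, ω y = q := fun q => q.2
  choose rep hrepY hrep using hrep
  let D : Set (ω '' Y) → Set K.Realization := fun A => {z | ∃ q ∈ A, ∃ g : G, g • rep q = z}
  have hDc : ∀ A, IsClosed (D A) := by
    intro A
    refine isClosed_of_injOn_support ?_ ?_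
    · rintro g _ ⟨q, hq, k, rfl⟩
      exact ⟨q, hq, g * k, mul_smul _ _ _⟩
    · rintro _ ⟨q, hq, k, rfl⟩ _ ⟨q', hq', k', rfl⟩ h
      obtain rfl : q = q' := by
        refine Subtype.ext ?_
        rw [← hrep q, ← hrep q', ← hω k (rep q), ← hω k' (rep q')]
        exact congrArg (Quotient.mk _) h
      exact smul_eq_of_support h
  -- The open set with index `q` omits the representatives of all other cells. As it is the only
  -- member of the cover containing `rep q`, a finite subcover must use every index.
  obtain ⟨A, hA⟩ := hY.elim_finite_subcover (fun q => (D {q}ᶜ)ᶜ)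
    (fun q => (hDc _).isOpen_compl) (fun y hy => by
      refine Set.mem_iUnion.2 ⟨⟨ω y, y, hy, rfl⟩, ?_⟩
      rintro ⟨q, hq, g, rfl⟩
      refine hq (Subtype.ext ?_)
      change q.1 = ω (g • rep q)
      rw [hω, hrep])
  classical
  refine ⟨A.image fun q => (rep q).coords.support, fun y hy => ?_⟩
  let q : ω '' Y := ⟨ω y, y, hy, rfl⟩
  obtain ⟨q', hq'A, hq'⟩ := Set.mem_iUnion₂.1 (hA (hrepY q))
  obtain rfl : q = q' := by
    by_contra h
    exact hq' ⟨q, h, 1, one_smul _ _⟩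
  refine ⟨_, Finset.mem_image_of_mem _ hq'A, ?_⟩
  obtain ⟨g, hg⟩ := Quotient.exact (hrep q)
  exact ⟨g⁻¹, eq_inv_smul_iff.2 hg⟩

end Compact

/-! ### Skeleta and generated subcomplexes -/

section Skeleta

variable {G V : Type*} [Group G] [MulAction G V] [DecidableEq V]
  {K L : AbstractSimplicialGComplex G V}

/-- The simplices of `K` that belong to `L` or have dimension at most `p`. -/
def skeletonFaces (K L : AbstractSimplicialGComplex G V) (p : ℤ) : Set (Finset V) :=
  {s | s ∈ K.faces ∧ ((s.card : ℤ) - 1 ≤ p ∨ s ∈ L.faces)}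

theorem isSubcomplex_skeletonFaces (p : ℤ) : K.IsSubcomplex (skeletonFaces K L p) where
  subset _ hs := hs.1
  lower s hs t hts ht := ⟨K.mem_of_subset hs.1 hts ht, hs.2.imp
    (fun h => by have := Finset.card_le_card hts; omega) fun h => L.mem_of_subset h hts ht⟩
  smul g s hs := ⟨K.smul_mem g s hs.1, hs.2.imp
    (fun h => by rwa [Finset.card_smul_finset]) (L.smul_mem g s)⟩

theorem skeleton_union_subspaceOf (p : ℤ) :
    K.skeleton p ∪ K.subspaceOf L = K.geom (skeletonFaces K L p) := by
  ext y
  constructor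
  · rintro (hy | ⟨s, hs, z, rfl⟩)
    · obtain ⟨s, z, -, rfl⟩ := Set.mem_iUnion.1 hy
      exact char_mem_geom (isSubcomplex_skeletonFaces p) s.1 ⟨s.1.2, Or.inl s.2⟩ z
    · exact char_mem_geom (isSubcomplex_skeletonFaces p) s ⟨s.2, Or.inr hs⟩ z
  · rintro ⟨hK, h | h⟩
    · obtain ⟨x, hx, hxy⟩ := K.exists_simplexPoint y
      exact Or.inl (Set.mem_iUnion.2 ⟨⟨⟨_, hK⟩, h⟩, (QuotientGroup.mk 1, x), hx, by
        rw [char_mk, one_smul, hxy]⟩)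
    · exact Or.inr ⟨⟨_, hK⟩, h, _, char_toSimplex_support y⟩

/-- The subcomplex generated by `F` and the orbits of the simplices in `T`. -/
def addOrbits (K : AbstractSimplicialGComplex G V) (F : Set (Finset V)) (T : Finset (Finset V)) :
    Set (Finset V) :=
  F ∪ {t | t ∈ K.faces ∧ ∃ s ∈ T, ∃ g : G, t ⊆ g • s}

theorem isSubcomplex_addOrbits {F : Set (Finset V)} (hF : K.IsSubcomplex F)
    (T : Finset (Finset V)) : K.IsSubcomplex (K.addOrbits F T) where
  subset := Set.union_subset hF.subset fun _ h => h.1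
  lower t ht u hut hu := ht.imp (fun h => hF.lower t h u hut hu)
    fun ⟨h, s, hs, g, hg⟩ => ⟨K.mem_of_subset h hut hu, s, hs, g, hut.trans hg⟩
  smul k t ht := ht.imp (hF.smul k t) fun ⟨h, s, hs, g, hg⟩ => ⟨K.smul_mem k t h, s, hs, k * g, by
    rw [mul_smul]; exact Finset.smul_finset_subset_smul_finset hg⟩

end Skeleta

end AbstractSimplicialGComplex

/-! ### Vanishing relative to a skeleton, and stability -/

namespace EquivariantHomologyTheory

open GPair AbstractSimplicialGComplex

variable {G V : Type u} [Group G] [TopologicalSpace G] [IsTopologicalGroup G]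
  [LocallyCompactSpace G] [MulAction G V] [DecidableEq V] {R : Type v} [Ring R]
  {h : EquivariantHomologyTheory.{u, v, w} G R}
  {K : AbstractSimplicialGComplex G V}

/-- Attaching finitely many equivariant cells of large dimension does not change homology. -/
theorem vanishes_of_finite_orbits {n₀ : ℤ} (hn₀ : ∀ n : ℤ, n ≤ n₀ → ∀ H : Subgroup G,
    Subsingleton ((h.H n).obj (space G (G ⧸ H)))) {n : ℤ} (T : Finset (Finset V))
    {F F' : Set (Finset V)} (hF : K.IsSubcomplex F) (hF' : K.IsSubcomplex F') (hFF' : F ⊆ F')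
    (hT : ∀ t ∈ F', t ∉ F → ∃ s ∈ T, ∃ g : G, t = g • s)
    (hdim : ∀ t ∈ F', t ∉ F → n - (t.card - 1) ≤ n₀) :
    h.Vanishes n ((space G K.Realization).subpair (K.geom F') (K.geom F)
      (isGInvariant_geom hF') (isGInvariant_geom hF)) := by
  induction hm : T.card using Nat.strong_induction_on generalizing T F with
  | _ m ih =>
  classical
  -- `N` collects the representatives still to be attached. A member of least cardinality has its
  -- whole boundary in `F`: a missing face would be a translate of a smaller member.
  let N := T.filter fun t => t ∈ F' ∧ t ∉ F
  rcases N.eq_empty_or_nonempty with hN | hN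
  · refine vanishes_of_sub_eq_univ n (Set.eq_univ_of_forall fun y => ?_)
    by_contra hy
    obtain ⟨s, hs, g, hg⟩ := hT _ y.2 hy
    have : s ∈ N := Finset.mem_filter.2 ⟨hs, (hF'.smul_mem_iff g s).1 (hg ▸ y.2),
      fun h => hy (by change _ ∈ F; rw [hg]; exact hF.smul g s h)⟩
    rw [hN] at this
    exact Finset.notMem_empty s this
  · obtain ⟨s, hsN, hmin⟩ := N.exists_min_image Finset.card hN
    obtain ⟨hsT, hsF', hsF⟩ := Finset.mem_filter.1 hsN
    have hsK := hF'.subset hsF'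
    have hs : ∀ u ⊂ s, u.Nonempty → u ∈ F := by
      intro u hu hne
      by_contra huF
      have huF' := hF'.lower s hsF' u hu.1 hne
      obtain ⟨s', hs', g, rfl⟩ := hT u huF' huF
      have h1 := hmin s' (Finset.mem_filter.2 ⟨hs', (hF'.smul_mem_iff g s').1 huF',
        fun h => huF (hF.smul g s' h)⟩)
      have h2 := Finset.card_lt_card hu
      rw [Finset.card_smul_finset] at h2
      omega
    have hF₁ := isSubcomplex_addOrbit hF hsK hs
    have hF₁F' : addOrbit G F s ⊆ F' :=
      Set.union_subset hFF' fun t ⟨g, hg⟩ => hg ▸ hF'.smul g s hsF'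
    have hcard : 0 < s.card := (K.isRelLowerSet_faces hsK).1.card_pos
    obtain ⟨p, hp⟩ : ∃ p, s.card = p + 1 := ⟨s.card - 1, by omega⟩
    refine Vanishes.trans (hY := isGInvariant_geom hF₁) (fun y hy => Or.inl hy)
      (fun y hy => hF₁F' hy) ?_
      (vanishes_addOrbit (p := p) hF ⟨s, hsK⟩ hsF hs hp (hn₀ _ ?_ _))
    · refine ih (T.erase s).card ?_ (T.erase s) hF₁ hF₁F' ?_
        (fun t ht htF => hdim t ht fun h => htF (Or.inl h)) rfl
      · rw [← hm]
        exact Finset.card_erase_lt_of_mem hsT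
      · intro t ht htF
        obtain ⟨s', hs', g, rfl⟩ := hT t ht fun h => htF (Or.inl h)
        exact ⟨s', Finset.mem_erase.2 ⟨fun h => htF (Or.inr ⟨g, h ▸ rfl⟩), hs'⟩, g, rfl⟩
    · have := hdim s hsF' hsF
      omega

/-- Compact supports reduce the claim to finitely many orbits of cells. Each has dimension at least
`p + 1`, so its orbit enters in degree at most `n - p - 1 ≤ n₀`. -/
theorem vanishes_withSub_skeleton (hcs : h.HasCompactSupports) {n₀ : ℤ}
    (hn₀ : ∀ n : ℤ, n ≤ n₀ → ∀ H : Subgroup G,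
      Subsingleton ((h.H n).obj (space G (G ⧸ H)))) {n p : ℤ} (hnp : n - p - 1 ≤ n₀)
    (L : AbstractSimplicialGComplex G V) :
    h.Vanishes n ((space G K.Realization).withSub (K.geom (skeletonFaces K L p))
      (isGInvariant_geom (isSubcomplex_skeletonFaces p))) := by
  set F := skeletonFaces K L p
  have hF : K.IsSubcomplex F := isSubcomplex_skeletonFaces p
  refine vanishes_of_eq_zero fun x => ?_
  obtain ⟨Y, B, hY, hB, hBF, -, hYc, -, y, rfl⟩ := hcs _ n x
  obtain ⟨T, hT⟩ := exists_finset_of_isCompact (K := K) hYc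
  have hF' := isSubcomplex_addOrbits hF T
  have hYF' : Y ⊆ K.geom (K.addOrbits F T) := fun y hy => by
    obtain ⟨s, hs, g, hg⟩ := hT y hy
    exact Or.inr ⟨y.support_mem, s, hs, g, hg.subset⟩
  have hv : h.Vanishes n ((space G K.Realization).subpair (K.geom (K.addOrbits F T)) (K.geom F)
      (isGInvariant_geom hF') (isGInvariant_geom hF)) := by
    -- The generated subcomplex also contains the faces of the cells that `Y` meets, so all subsets
    -- of members of `T` serve as representatives.
    refine vanishes_of_finite_orbits hn₀ (T.biUnion Finset.powerset) hF hF' Set.subset_union_left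
      (fun t ht htF => ?_) fun t ht htF => ?_
    · obtain ⟨-, s, hs, g, hg⟩ := ht.resolve_left htF
      refine ⟨g⁻¹ • t, Finset.mem_biUnion.2 ⟨s, hs, Finset.mem_powerset.2 ?_⟩, g,
        (smul_inv_smul g t).symm⟩
      exact Finset.smul_finset_subset_iff.2 (by simpa using hg)
    · have : ¬ ((t.card : ℤ) - 1 ≤ p) := fun hle => htF ⟨hF'.subset ht, Or.inl hle⟩
      omega
  let P := (space G K.Realization).withSub (K.geom F) (isGInvariant_geom hF)
  -- The inclusion of `(Y, B)` passes through `(|F'|, |F|)`, which has no homology in degree `n`.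
  have e : P.subpairIncl Y B hY hB hBF =
      P.subpairMap hY hB (isGInvariant_geom hF') (isGInvariant_geom hF) hYF' hBF ≫
        P.subpairIncl _ _ _ _ subset_rfl := hom_ext fun _ => rfl
  change ((h.H n).map (P.subpairIncl Y B hY hB hBF)).hom y = 0
  rw [e, map_comp_apply]
  exact (congrArg _ (Vanishes.eq_zero hv _)).trans (map_zero _)

end EquivariantHomologyTheory

theorem mainTheorem6 {G : Type u} [Group G] [TopologicalSpace G] [IsTopologicalGroup G]
    [LocallyCompactSpace G] [T2Space G] {R : Type v} [Ring R]
    (h : EquivariantHomologyTheory.{u, v, w} G R) (hcs : h.HasCompactSupports)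
    (n₀ : ℤ) (hn₀ : ∀ n : ℤ, n ≤ n₀ → ∀ H : Subgroup G,
      Subsingleton ((h.H n).obj (GPair.space G (G ⧸ H))))
    {V : Type u} [MulAction G V] [DecidableEq V]
    (K L : AbstractSimplicialGComplex G V) (hLK : L.faces ⊆ K.faces)
    (hX : ∀ p : ℤ, IsCompact ((skeletalFiltration K L hLK).level p)) :
    (skeletalFiltration K L hLK).HomologicallyStable h := by
  intro n
  -- Injectivity in degree `n` needs vanishing of `(X, X_p)` in degree `m = n + 1`, and surjectivity
  -- needs it in degree `n`. The threshold `m - n₀ - 1` is what `k - p - 1 ≤ n₀` requires for all `k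
  -- ≤ m`.
  obtain ⟨m, rfl⟩ : ∃ m, n = m - 1 := ⟨n + 1, by ring⟩
  refine ⟨m - n₀ - 1, fun p hp => ?_⟩
  let P := simplicialPair K L hLK
  let Y : Set P.carrier := (skeletalFiltration K L hLK).level p
  have hY : IsGInvariant G Y := (skeletalFiltration K L hLK).invariant p
  have hPY : P.sub ⊆ Y := Set.subset_union_right
  have hv : ∀ k ≤ m, h.Vanishes k (P.withSub Y hY) := by
    intro k hk
    rw [P.withSub_congr (Y := Y) (AbstractSimplicialGComplex.skeleton_union_subspaceOf p) hY
      (AbstractSimplicialGComplex.isGInvariant_geom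
        (AbstractSimplicialGComplex.isSubcomplex_skeletonFaces p))]
    exact EquivariantHomologyTheory.vanishes_withSub_skeleton hcs hn₀ (by omega) L
  refine (ConcreteCategory.isIso_iff_bijective _).2
    ⟨EquivariantHomologyTheory.map_subpairIncl_injective (P := P) hY hPY (hv m le_rfl), fun x => ?_⟩
  exact EquivariantHomologyTheory.exact_triple_total (P := P) hY hPY (m - 1) x
    ((hv (m - 1) (by omega)).eq_zero _)
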